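/- Let $\mathcal C$ be a category with finite products and let $\mathrm{Ab}(\mathcal C)$ be the category of abelian group objects in $\mathcal C$. For $A, A', B \in \mathrm{Ab}(\mathcal C)$, a morphism $b\colon A\times A'\to B$ of $\mathcal C$ is called bilinear if for every object $X$ of $\mathcal C$ the induced map $\mathrm{Hom}_{\mathcal C}(X,A)\times \mathrm{Hom}_{\mathcal C}(X,A')\to \mathrm{Hom}_{\mathcal C}(X,B)$ is a bilinear map of abelian groups. A tensor product of $A$ and $A'$ is an object $A\otimes A'$ of $\mathrm{Ab}(\mathcal C)$ together with a bilinear morphism $a\colon A\times A'\to A\otimes A'$ such that for every $B\in\mathrm{Ab}(\mathcal C)$ the map $f\mapsto f\circ a$ is a bijection from $\mathrm{Hom}_{\mathrm{Ab}(\mathcal C)}(A\otimes A',B)$ onto the set of bilinear morphisms $A\times A'\to B$. Let $k$ be a field. 1. Let $\mathrm{Hopf}_k$ be the category of abelian (that is, commutative and cocommutative) Hopf algebras over $k$, regarded as abelian group objects in the category of cocommutative $k$-coalgebras, in which the product is $\otimes_k$. Then any two objects of $\mathrm{Hopf}_k$ have a tensor product in $\mathrm{Hopf}_k$. 2. If $k$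 is perfect, then any two objects of the category of abelian affine group schemes over $k$, that is, of abelian group objects in the category of affine schemes over $k$, have a tensor product in that category. -/

import Mathlib

universe u

open CategoryTheory

noncomputable section

namespace AbTensor

open MonoidalCategory CartesianMonoidalCategory MonObj
open scoped TensorProduct

/-! ### Bilinear morphisms and tensor products of abelian group objects -/

section General

universe v₁ u₁ v₂ u₂

variable {C : Type u₁} [Category.{v₁} C] [CartesianMonoidalCategory C] [BraidedCategory C]

/-- A morphism `b : A × A' ⟶ B` between abelian group objects is bilinear if the map
`Hom(X, A) × Hom(X, A') → Hom(X, B)` that it induces is bilinear for every object `X`. The groups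
`Hom(X, A)`, `Hom(X, A')`, `Hom(X, B)` are written multiplicatively, as in Mathlib. -/
structure IsBilinear {A A' B : CommGrp C} (b : A.X ⊗ A'.X ⟶ B.X) : Prop where
  map_mul_left : ∀ (X : C) (f₁ f₂ : X ⟶ A.X) (g : X ⟶ A'.X),
    lift (f₁ * f₂) g ≫ b = (lift f₁ g ≫ b) * (lift f₂ g ≫ b)
  map_mul_right : ∀ (X : C) (f : X ⟶ A.X) (g₁ g₂ : X ⟶ A'.X),
    lift f (g₁ * g₂) ≫ b = (lift f g₁ ≫ b) * (lift f g₂ ≫ b)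

variable {D : Type u₂} [Category.{v₂} D]

/-- Let `F : D ⥤ Ab(C)` present the objects of `D` as abelian group objects in `C`. The object `T`
of `D` with the morphism `a : A × A' ⟶ T` of `C` is a tensor product of `A` and `A'` if `a` is
bilinear and `φ ↦ φ ∘ a` is a bijection from the morphisms `T ⟶ B` of `D` to the bilinear morphisms
`A × A' ⟶ B` of `C`, for every `B` in `D`. -/
structure IsTensorProduct (F : D ⥤ CommGrp C) (A A' T : D)
    (a : (F.obj A).X ⊗ (F.obj A').X ⟶ (F.obj T).X) : Prop where
  isBilinear : IsBilinear a
  existsUnique : ∀ (B : D) (b : (F.obj A).X ⊗ (F.obj A').X ⟶ (F.obj B).X), IsBilinear b →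
    ∃! φ : T ⟶ B, a ≫ (CommGrp.forget C).map (F.map φ) = b

/-- Every two objects of `D` have a tensor product. -/
def HasTensorProducts (F : D ⥤ CommGrp C) : Prop :=
  ∀ A A' : D, ∃ (T : D) (a : (F.obj A).X ⊗ (F.obj A').X ⟶ (F.obj T).X), IsTensorProduct F A A' T a

end General

/-! ### Cocommutative coalgebras -/

/-- Cocommutative (coassociative, counital) coalgebras over `k`. -/
structure CocommCoalgCat (k : Type u) [Field k] where
  carrier : Type u
  [addCommGroup : AddCommGroup carrier]
  [module : Module k carrier]
  [coalgebra : Coalgebra k carrier]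
  [isCocomm : Coalgebra.IsCocomm k carrier]

namespace CocommCoalgCat

attribute [instance] addCommGroup module coalgebra isCocomm

variable {k : Type u} [Field k]

/-- Morphisms of cocommutative coalgebras are coalgebra homomorphisms. -/
@[ext]
structure Hom (C D : CocommCoalgCat k) where
  hom : C.carrier →ₗc[k] D.carrier

instance : Category (CocommCoalgCat k) where
  Hom C D := Hom C D
  id C := ⟨CoalgHom.id k C.carrier⟩
  comp f g := ⟨g.hom.comp f.hom⟩

@[ext]
theorem hom_ext {C D : CocommCoalgCat k} {f g : C ⟶ D} (h : f.hom = g.hom) : f = g :=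
  Hom.ext h

@[simp]
theorem id_hom (C : CocommCoalgCat k) : Hom.hom (𝟙 C) = CoalgHom.id k C.carrier := rfl

@[simp]
theorem comp_hom {C D E : CocommCoalgCat k} (f : C ⟶ D) (g : D ⟶ E) :
    (f ≫ g).hom = g.hom.comp f.hom := rfl

section

variable {M N P : Type u} [AddCommGroup M] [AddCommGroup N] [AddCommGroup P] [Module k M]
  [Module k N] [Module k P] [Coalgebra k M] [Coalgebra k N]

theorem map_counit_right (f : M →ₗ[k] P) (x : M) :
    TensorProduct.rid k P (TensorProduct.map f Coalgebra.counit (Coalgebra.comul (R := k) x)) =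
      f x := by
  have h := Coalgebra.lTensor_counit_comul (R := k) x
  rw [← LinearMap.rTensor_comp_lTensor, LinearMap.comp_apply, h]
  simp

theorem map_counit_left (f : M →ₗ[k] P) (x : M) :
    TensorProduct.lid k P (TensorProduct.map Coalgebra.counit f (Coalgebra.comul (R := k) x)) =
      f x := by
  have h := Coalgebra.rTensor_counit_comul (R := k) x
  rw [← LinearMap.lTensor_comp_rTensor, LinearMap.comp_apply, h]
  simp

variable (M N) in
theorem map_fst_snd_comul :
    TensorProduct.map
      ((TensorProduct.rid k M).toLinearMap ∘ₗ TensorProduct.map LinearMap.id Coalgebra.counit)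
      ((TensorProduct.lid k N).toLinearMap ∘ₗ TensorProduct.map Coalgebra.counit LinearMap.id) ∘ₗ
        Coalgebra.comul (R := k) (A := M ⊗[k] N) = LinearMap.id := by
  ext c d
  have hc := map_counit_right (k := k) LinearMap.id c
  have hd := map_counit_left (k := k) LinearMap.id d
  change TensorProduct.map _ _
    (TensorProduct.AlgebraTensorModule.tensorTensorTensorComm k k k k _ _ _ _
      (Coalgebra.comul (R := k) c ⊗ₜ[k] Coalgebra.comul (R := k) d)) = c ⊗ₜ[k] d
  conv_rhs => rw [← LinearMap.id_apply (R := k) c, ← LinearMap.id_apply (R := k) d, ← hc, ← hd]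
  generalize Coalgebra.comul (R := k) c = x
  generalize Coalgebra.comul (R := k) d = y
  induction x with
  | zero => simp
  | add x₁ x₂ h₁ h₂ => simp only [TensorProduct.add_tmul, map_add, h₁, h₂]
  | tmul c₁ c₂ =>
    induction y with
    | zero => simp
    | add y₁ y₂ h₁ h₂ => simp only [TensorProduct.tmul_add, map_add, h₁, h₂]
    | tmul d₁ d₂ =>
      simp [TensorProduct.smul_tmul, TensorProduct.tmul_smul, smul_smul, mul_comm]

end

/-- The coalgebra `k`. -/
abbrev unit (k : Type u) [Field k] : CocommCoalgCat k := ⟨k⟩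

/-- The tensor product coalgebra. -/
abbrev prod (C D : CocommCoalgCat k) : CocommCoalgCat k := ⟨C.carrier ⊗[k] D.carrier⟩

def toUnitHom (C : CocommCoalgCat k) : C ⟶ unit k := ⟨Coalgebra.counitCoalgHom k C.carrier⟩

/-- The projection `c ⊗ d ↦ ε(d) c`. -/
def prodFst (C D : CocommCoalgCat k) : prod C D ⟶ C :=
  ⟨((Coalgebra.TensorProduct.rid k k C.carrier : _ →ₗc[k] _)).comp
    (Coalgebra.TensorProduct.map (CoalgHom.id k C.carrier)
      (Coalgebra.counitCoalgHom k D.carrier))⟩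

/-- The projection `c ⊗ d ↦ ε(c) d`. -/
def prodSnd (C D : CocommCoalgCat k) : prod C D ⟶ D :=
  ⟨((Coalgebra.TensorProduct.lid k D.carrier : _ →ₗc[k] _)).comp
    (Coalgebra.TensorProduct.map (Coalgebra.counitCoalgHom k C.carrier)
      (CoalgHom.id k D.carrier))⟩

/-- The morphism `x ↦ ∑ f(x₁) ⊗ g(x₂)`. -/
def prodLift {X C D : CocommCoalgCat k} (f : X ⟶ C) (g : X ⟶ D) : X ⟶ prod C D :=
  ⟨(Coalgebra.TensorProduct.map f.hom g.hom).comp (Coalgebra.comulCoalgHom k X.carrier)⟩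

theorem prodLift_fst {X C D : CocommCoalgCat k} (f : X ⟶ C) (g : X ⟶ D) :
    prodLift f g ≫ prodFst C D = f := by
  ext x
  change TensorProduct.rid k C.carrier (TensorProduct.map LinearMap.id Coalgebra.counit
    (TensorProduct.map f.hom.toLinearMap g.hom.toLinearMap (Coalgebra.comul x))) = f.hom x
  rw [← LinearMap.comp_apply (TensorProduct.map _ _), ← TensorProduct.map_comp,
    g.hom.counit_comp, LinearMap.id_comp]
  exact map_counit_right f.hom.toLinearMap x

theorem prodLift_snd {X C D : CocommCoalgCat k} (f : X ⟶ C) (g : X ⟶ D) :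
    prodLift f g ≫ prodSnd C D = g := by
  ext x
  change TensorProduct.lid k D.carrier (TensorProduct.map Coalgebra.counit LinearMap.id
    (TensorProduct.map f.hom.toLinearMap g.hom.toLinearMap (Coalgebra.comul x))) = g.hom x
  rw [← LinearMap.comp_apply (TensorProduct.map _ _), ← TensorProduct.map_comp,
    f.hom.counit_comp, LinearMap.id_comp]
  exact map_counit_left g.hom.toLinearMap x

theorem prodLift_fst_snd (C D : CocommCoalgCat k) :
    prodLift (prodFst C D) (prodSnd C D) = 𝟙 (prod C D) := by
  apply hom_ext
  apply CoalgHom.coe_linearMap_injective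
  exact map_fst_snd_comul C.carrier D.carrier

theorem prodLift_comp {X C D : CocommCoalgCat k} (m : X ⟶ prod C D) :
    prodLift (m ≫ prodFst C D) (m ≫ prodSnd C D) =
      m ≫ prodLift (prodFst C D) (prodSnd C D) := by
  ext x
  change TensorProduct.map ((prodFst C D).hom.toLinearMap ∘ₗ m.hom.toLinearMap)
    ((prodSnd C D).hom.toLinearMap ∘ₗ m.hom.toLinearMap) (Coalgebra.comul x) =
    TensorProduct.map (prodFst C D).hom.toLinearMap (prodSnd C D).hom.toLinearMap
      (Coalgebra.comul (m.hom x))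
  rw [← CoalgHomClass.map_comp_comul_apply, TensorProduct.map_comp]
  rfl

theorem prod_hom_ext {X C D : CocommCoalgCat k} (m m' : X ⟶ prod C D)
    (h₁ : m ≫ prodFst C D = m' ≫ prodFst C D) (h₂ : m ≫ prodSnd C D = m' ≫ prodSnd C D) :
    m = m' := by
  have h := prodLift_comp m
  rw [h₁, h₂, prodLift_comp, prodLift_fst_snd, Category.comp_id, Category.comp_id] at h
  exact h.symm

theorem toUnitHom_uniq (C : CocommCoalgCat k) (f : C ⟶ unit k) : f = toUnitHom C := by
  apply hom_ext
  apply CoalgHom.coe_linearMap_injective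
  exact f.hom.counit_comp

/-- The product of cocommutative coalgebras is the tensor product over `k`, the terminal object
is `k`. -/
instance : CartesianMonoidalCategory (CocommCoalgCat k) :=
  .ofChosenFiniteProducts
    ⟨Limits.asEmptyCone (unit k), Limits.IsTerminal.ofUniqueHom toUnitHom toUnitHom_uniq⟩
    fun C D ↦ ⟨Limits.BinaryFan.mk (prodFst C D) (prodSnd C D),
      Limits.BinaryFan.IsLimit.mk _ prodLift prodLift_fst prodLift_snd
        fun f g _ h₁ h₂ ↦ prod_hom_ext _ _ (h₁.trans (prodLift_fst f g).symm)
          (h₂.trans (prodLift_snd f g).symm)⟩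

instance : BraidedCategory (CocommCoalgCat k) := .ofCartesianMonoidalCategory

theorem lift_eq {X C D : CocommCoalgCat k} (f : X ⟶ C) (g : X ⟶ D) :
    lift f g = prodLift f g :=
  prod_hom_ext _ _ ((lift_fst f g).trans (prodLift_fst f g).symm)
    ((lift_snd f g).trans (prodLift_snd f g).symm)

theorem tensorHom_eq {C C' D D' : CocommCoalgCat k} (f : C ⟶ C') (g : D ⟶ D') :
    f ⊗ₘ g = (⟨Coalgebra.TensorProduct.map f.hom g.hom⟩ : prod C D ⟶ prod C' D') := by
  apply prod_hom_ext
  · refine (tensorHom_fst f g).trans ?_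
    apply hom_ext
    apply CoalgHom.coe_linearMap_injective
    refine TensorProduct.ext' fun c d ↦ ?_
    change f.hom (Coalgebra.counit (R := k) d • c) = Coalgebra.counit (R := k) (g.hom d) • f.hom c
    simp
  · refine (tensorHom_snd f g).trans ?_
    apply hom_ext
    apply CoalgHom.coe_linearMap_injective
    refine TensorProduct.ext' fun c d ↦ ?_
    change g.hom (Coalgebra.counit (R := k) c • d) = Coalgebra.counit (R := k) (f.hom c) • g.hom d
    simp

theorem whiskerRight_eq {C C' : CocommCoalgCat k} (f : C ⟶ C') (D : CocommCoalgCat k) :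
    f ▷ D =
      (⟨Coalgebra.TensorProduct.map f.hom (CoalgHom.id k D.carrier)⟩ : prod C D ⟶ prod C' D) :=
  (tensorHom_id f D).symm.trans (tensorHom_eq f (𝟙 D))

theorem whiskerLeft_eq (C : CocommCoalgCat k) {D D' : CocommCoalgCat k} (g : D ⟶ D') :
    C ◁ g =
      (⟨Coalgebra.TensorProduct.map (CoalgHom.id k C.carrier) g.hom⟩ : prod C D ⟶ prod C D') :=
  (id_tensorHom C g).symm.trans (tensorHom_eq (𝟙 C) g)

theorem leftUnitor_hom_eq (C : CocommCoalgCat k) :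
    (λ_ C).hom = 
      (⟨(Coalgebra.TensorProduct.lid k C.carrier : k ⊗[k] C.carrier →ₗc[k] C.carrier)⟩ :
        prod (unit k) C ⟶ C) := by
  refine (leftUnitor_hom C).trans ?_
  apply hom_ext
  apply CoalgHom.coe_linearMap_injective
  exact TensorProduct.ext' fun c d ↦ rfl

theorem rightUnitor_hom_eq (C : CocommCoalgCat k) :
    (ρ_ C).hom = 
      (⟨(Coalgebra.TensorProduct.rid k k C.carrier : C.carrier ⊗[k] k →ₗc[k] C.carrier)⟩ :
        prod C (unit k) ⟶ C) := by
  refine (rightUnitor_hom C).trans ?_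
  apply hom_ext
  apply CoalgHom.coe_linearMap_injective
  exact TensorProduct.ext' fun c d ↦ rfl

theorem associator_hom_eq (C D E : CocommCoalgCat k) :
    (α_ C D E).hom =
      (⟨(Coalgebra.TensorProduct.assoc k k C.carrier D.carrier E.carrier :
        (C.carrier ⊗[k] D.carrier) ⊗[k] E.carrier →ₗc[k] C.carrier ⊗[k] (D.carrier ⊗[k] E.carrier))⟩ :
        prod (prod C D) E ⟶ prod C (prod D E)) := by
  apply prod_hom_ext
  · refine (associator_hom_fst C D E).trans ?_
    apply hom_ext
    apply CoalgHom.coe_linearMap_injective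
    refine TensorProduct.ext_threefold fun c d e ↦ ?_
    change Coalgebra.counit (R := k) d • Coalgebra.counit (R := k) e • c =
      Coalgebra.counit (R := k) (A := D.carrier ⊗[k] E.carrier) (d ⊗ₜ[k] e) • c
    simp [smul_smul, mul_comm]
  · apply prod_hom_ext
    · refine (Category.assoc _ _ _).trans ((associator_hom_snd_fst C D E).trans ?_)
      apply hom_ext
      apply CoalgHom.coe_linearMap_injective
      refine TensorProduct.ext_threefold fun c d e ↦ ?_
      change (prodSnd C D).hom.toLinearMap (Coalgebra.counit (R := k) e • (c ⊗ₜ[k] d)) =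
        (prodFst D E).hom.toLinearMap (Coalgebra.counit (R := k) c • (d ⊗ₜ[k] e))
      rw [map_smul, map_smul]
      change Coalgebra.counit (R := k) e • Coalgebra.counit (R := k) c • d = Coalgebra.counit (R := k) c • Coalgebra.counit (R := k) e • d
      exact smul_comm _ _ _
    · refine (Category.assoc _ _ _).trans ((associator_hom_snd_snd C D E).trans ?_)
      apply hom_ext
      apply CoalgHom.coe_linearMap_injective
      refine TensorProduct.ext_threefold fun c d e ↦ ?_
      change Coalgebra.counit (R := k) (A := C.carrier ⊗[k] D.carrier) (c ⊗ₜ[k] d) • e =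
        (prodSnd D E).hom.toLinearMap (Coalgebra.counit (R := k) c • (d ⊗ₜ[k] e))
      rw [map_smul]
      change _ = Coalgebra.counit (R := k) c • Coalgebra.counit (R := k) d • e
      simp [smul_smul, mul_comm]

def commHom (C D : CocommCoalgCat k) : prod C D ⟶ prod D C :=
  ⟨{ toLinearMap := (TensorProduct.comm k C.carrier D.carrier).toLinearMap
     counit_comp := by ext; simp [mul_comm]
     map_comp_comul := by
       ext x y
       simp [← (Coalgebra.Repr.arbitrary k x).eq, ← (Coalgebra.Repr.arbitrary k y).eq,
         TensorProduct.tmul_sum, TensorProduct.sum_tmul]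
       exact Finset.sum_comm }⟩

theorem braiding_hom_eq (C D : CocommCoalgCat k) : (β_ C D).hom = commHom C D := by
  apply prod_hom_ext
  · refine (braiding_hom_fst C D).trans ?_
    apply hom_ext
    apply CoalgHom.coe_linearMap_injective
    exact TensorProduct.ext' fun c d ↦ rfl
  · refine (braiding_hom_snd C D).trans ?_
    apply hom_ext
    apply CoalgHom.coe_linearMap_injective
    exact TensorProduct.ext' fun c d ↦ rfl

end CocommCoalgCat

/-! ### Abelian Hopf algebras -/

/-- The category of abelian, i.e. commutative and cocommutative, Hopf algebras over `k`; the
morphisms are the bialgebra homomorphisms. -/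
abbrev AbHopf (k : Type u) [Field k] :=
  ObjectProperty.FullSubcategory fun H : CommHopfAlgCat.{u} k ↦ Coalgebra.IsCocomm k H

namespace AbHopf

variable {k : Type u} [Field k]

instance (H : AbHopf k) : Coalgebra.IsCocomm k H.obj := H.property

/-- The underlying coalgebra. -/
abbrev coalg (H : AbHopf k) : CocommCoalgCat k := ⟨H.obj⟩

section

variable (A : Type u) [CommRing A] [HopfAlgebra k A] [Coalgebra.IsCocomm k A]

theorem map_antipode_comp_comul :
    TensorProduct.map (HopfAlgebra.antipode k (A := A)) (HopfAlgebra.antipode k (A := A)) ∘ₗ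
      Coalgebra.comul = Coalgebra.comul ∘ₗ HopfAlgebra.antipode k (A := A) := by
  have key (f g : A →ₐ[k] A) (x : A) :
      (WithConv.toConv ((Algebra.TensorProduct.includeLeft (R := k) (A := A) (B := A)).comp f) *
        WithConv.toConv ((Algebra.TensorProduct.includeRight (R := k) (A := A) (B := A)).comp g)).ofConv
          x = TensorProduct.map f.toLinearMap g.toLinearMap (Coalgebra.comul (R := k) x) := by
    refine (AlgHom.convMul_apply _ _ _).trans ?_
    induction Coalgebra.comul (R := k) x with
    | zero => simp
    | add x₁ x₂ h₁ h₂ => simp only [map_add, h₁, h₂]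
    | tmul c₁ c₂ => simp
  have h : WithConv.toConv (Bialgebra.comulAlgHom k A) =
      WithConv.toConv (Algebra.TensorProduct.includeLeft (R := k) (A := A) (B := A)) *
        WithConv.toConv (Algebra.TensorProduct.includeRight (R := k) (A := A) (B := A)) := by
    apply WithConv.ofConv_injective
    ext x
    refine Eq.trans ?_ (key (AlgHom.id k A) (AlgHom.id k A) x).symm
    simp
  have h' := (congrArg Inv.inv h).trans (mul_inv
    (WithConv.toConv (Algebra.TensorProduct.includeLeft (R := k) (A := A) (B := A)))
    (WithConv.toConv (Algebra.TensorProduct.includeRight (R := k) (A := A) (B := A))))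
  ext x
  have h'' := DFunLike.congr_fun (congrArg WithConv.ofConv h') x
  exact ((key (HopfAlgebra.antipodeAlgHom k A) (HopfAlgebra.antipodeAlgHom k A) x).symm.trans
    h''.symm)

/-- The antipode of an abelian Hopf algebra is a coalgebra homomorphism. -/
def antipodeCoalgHom : A →ₗc[k] A where
  toLinearMap := HopfAlgebra.antipode k (A := A)
  counit_comp := HopfAlgebra.counit_comp_antipode
  map_comp_comul := map_antipode_comp_comul A

end

/-- An abelian Hopf algebra is an abelian group object in cocommutative coalgebras, by its own
unit, multiplication and antipode. -/
instance (H : AbHopf k) : GrpObj H.coalg where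
  one := ⟨(Bialgebra.unitBialgHom k H.obj : k →ₗc[k] H.obj)⟩
  mul := ⟨Bialgebra.mulCoalgHom k H.obj⟩
  inv := ⟨antipodeCoalgHom H.obj⟩
  one_mul := by
    rw [CocommCoalgCat.whiskerRight_eq, CocommCoalgCat.leftUnitor_hom_eq]
    apply CocommCoalgCat.hom_ext
    apply CoalgHom.coe_linearMap_injective
    refine TensorProduct.ext' fun c d ↦ ?_
    exact (Algebra.smul_def (R := k) (A := H.obj) c d).symm
  mul_one := by
    rw [CocommCoalgCat.whiskerLeft_eq, CocommCoalgCat.rightUnitor_hom_eq]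
    apply CocommCoalgCat.hom_ext
    apply CoalgHom.coe_linearMap_injective
    refine TensorProduct.ext' fun c d ↦ ?_
    exact (mul_comm (G := H.obj) _ _).trans (Algebra.smul_def (R := k) (A := H.obj) d c).symm
  mul_assoc := by
    rw [CocommCoalgCat.whiskerLeft_eq, CocommCoalgCat.whiskerRight_eq,
      CocommCoalgCat.associator_hom_eq]
    apply CocommCoalgCat.hom_ext
    apply CoalgHom.coe_linearMap_injective
    refine TensorProduct.ext_threefold fun c d e ↦ ?_
    exact mul_assoc (G := H.obj) c d e
  left_inv := by
    rw [CocommCoalgCat.lift_eq]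
    apply CocommCoalgCat.hom_ext
    ext x
    exact HopfAlgebra.mul_antipode_rTensor_comul_apply (R := k) (A := H.obj) x
  right_inv := by
    rw [CocommCoalgCat.lift_eq]
    apply CocommCoalgCat.hom_ext
    ext x
    exact HopfAlgebra.mul_antipode_lTensor_comul_apply (R := k) (A := H.obj) x

instance (H : AbHopf k) : IsCommMonObj H.coalg where
  mul_comm := by
    rw [CocommCoalgCat.braiding_hom_eq]
    apply CocommCoalgCat.hom_ext
    apply CoalgHom.coe_linearMap_injective
    refine TensorProduct.ext' fun c d ↦ ?_
    exact mul_comm (G := H.obj) d c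

variable (k) in
/-- Abelian Hopf algebras as abelian group objects in cocommutative coalgebras. -/
def toCommGrp : AbHopf k ⥤ CommGrp (CocommCoalgCat k) where
  obj H := ⟨H.coalg⟩
  map {H K} f := InducedCategory.homMk (Grp.homMk'
    { hom := ⟨(f.hom.hom : H.obj →ₗc[k] K.obj)⟩
      isMonHom_hom :=
        { one_hom := by
            apply CocommCoalgCat.hom_ext
            ext
            change f.hom.hom (algebraMap k H.obj 1) = algebraMap k K.obj 1
            rw [map_one, map_one, map_one]
          mul_hom := by
            rw [CocommCoalgCat.tensorHom_eq]
            apply CocommCoalgCat.hom_ext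
            apply CoalgHom.coe_linearMap_injective
            refine TensorProduct.ext' fun c d ↦ ?_
            exact map_mul f.hom.hom c d } })

end AbHopf

/-! ### Affine group schemes -/

/-- The property of a scheme over `Spec k` to be affine. -/
def isAffineOver (k : Type u) [Field k] :
    ObjectProperty (Over (AlgebraicGeometry.Spec (CommRingCat.of k))) :=
  fun X ↦ AlgebraicGeometry.IsAffine X.left

/-- The category of affine schemes over `k`. -/
abbrev AffSch (k : Type u) [Field k] := (isAffineOver k).FullSubcategory

section

variable (k : Type u) [Field k]

instance : (isAffineOver k).IsClosedUnderIsomorphisms where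
  of_iso {X Y} e h := by
    have : AlgebraicGeometry.IsAffine X.left := h
    have : IsIso e.inv.left := inferInstanceAs (IsIso ((Over.forget _).map e.inv))
    exact AlgebraicGeometry.IsAffine.of_isIso e.inv.left

instance : (isAffineOver k).IsClosedUnderLimitsOfShape (Discrete PEmpty.{1}) where
  limitsOfShape_le := by
    rintro X ⟨pres⟩
    have e : 𝟙_ (Over (AlgebraicGeometry.Spec (CommRingCat.of k))) ≅ X :=
      isTerminalTensorUnit.uniqueUpToIso
        ((Limits.IsLimit.postcomposeHomEquiv (Functor.emptyExt _ _) _).symm pres.isLimit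
          |>.ofIsoLimit (Limits.Cone.ext (Iso.refl _) (by rintro ⟨⟨⟩⟩)))
    exact (isAffineOver k).prop_of_iso e
      (inferInstanceAs (AlgebraicGeometry.IsAffine (AlgebraicGeometry.Spec (CommRingCat.of k))))

instance : (isAffineOver k).IsClosedUnderLimitsOfShape (Discrete Limits.WalkingPair) where
  limitsOfShape_le := by
    rintro X ⟨pres⟩
    have h₁ : AlgebraicGeometry.IsAffine (pres.diag.obj ⟨.left⟩).left := pres.prop_diag_obj _
    have h₂ : AlgebraicGeometry.IsAffine (pres.diag.obj ⟨.right⟩).left := pres.prop_diag_obj _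
    have e : pres.diag.obj ⟨.left⟩ ⊗ pres.diag.obj ⟨.right⟩ ≅ X :=
      (tensorProductIsBinaryProduct _ _).conePointUniqueUpToIso
        ((Limits.IsLimit.postcomposeHomEquiv (Limits.diagramIsoPair _) _).symm pres.isLimit)
    exact (isAffineOver k).prop_of_iso e
      (inferInstanceAs (AlgebraicGeometry.IsAffine (Limits.pullback
        (pres.diag.obj ⟨.left⟩).hom (pres.diag.obj ⟨.right⟩).hom)))

/-- The category of affine schemes over `k` has the products of schemes over `k`. -/
instance : CartesianMonoidalCategory (AffSch k) := CartesianMonoidalCategory.fullSubcategory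

instance : BraidedCategory (AffSch k) := .ofCartesianMonoidalCategory

end

/-- The category of abelian affine group schemes over `k`: the abelian group objects in affine
schemes over `k`. -/
abbrev AbSch (k : Type u) [Field k] := CommGrp (AffSch k)

end AbTensor

end

/-!
Both parts construct the object `T` that represents bilinear maps.

In the opposite of commutative algebras, abelian group objects `A`, `A'`, `B` are abelian Hopf
algebras, and a bilinear morphism is an algebra homomorphism `b : B → A ⊗ A'`. Adding up its values
at `n` points gives homomorphisms `powSum b n : B → (A ⊗ A')^⊗n` for all `n ≥ 0`. Let
`T = TensorAlg k A A'` be the set of the sequences `(powSum b n x)ₙ`, for all `b` and all `x` in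
`B`, in the product of the algebras `(A ⊗ A')^⊗n`. It is a subalgebra, because two bilinear
morphisms have a sum `B ⊗ B' → A ⊗ A'`. Splitting `m + n` points into `n` and `m` points maps
`(A ⊗ A')^⊗(m + n)` to `(A ⊗ A')^⊗n ⊗ (A ⊗ A')^⊗m`, and it sends `powSum b (m + n) x` to the image
of the comultiplication of `x` (`tpowSplit_comp_powSum`). As the pairs of terms separate the
elements of `T ⊗ T`, which is linear algebra over a field (`eq_zero_of_forall_map_eq_zero`), this
defines a comultiplication on `T` (`TensorAlg.exists_comul`). In the same way, inversion on `A`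
defines the antipode (`TensorAlg.exists_antipode`). All identities in `T` can be checked on the
images of the algebras `B`, where they hold because `B` is an abelian Hopf algebra. Taking a
sequence to its term at `n = 1` is the universal bilinear morphism `T → A ⊗ A'`. A bilinear `b`
factors through it by the map `x ↦ (powSum b n x)ₙ`, and in no other way, because `powSum` of the
universal morphism recovers the whole sequence (`TensorAlg.powSum_univ`,
`TensorAlg.existsUnique_comp_eq`). Finally, `Spec` is an equivalence from the opposite of
commutative algebras to affine schemes (`affSpec`), and the existence of tensor products is
invariant under equivalence (`HasTensorProducts.of_equivalence`).

For abelian Hopf algebras as group objects in cocommutative coalgebras, bilinearity makes sense for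
linear maps `φ : A ⊗ A' → R` to any commutative algebra `R`: convolution replaces the group
structure on `Hom(X, B)` (`IsBilinearLinearMap`). The quotient `T = HopfTensor A A'` of the
symmetric algebra on `A ⊗ A'` by the elements that all bilinear `φ` annihilate represents these
maps, in the sense that algebra homomorphisms `T → R` are bilinear maps `A ⊗ A' → R`. Bilinear maps
are closed under convolution, and precomposition with inversion on `A` inverts them
(`IsBilinearLinearMap.mul`, `IsBilinearLinearMap.comp_invLeft_mul_self`). This makes `T` a Hopf
algebra for which the universal map `A ⊗ A' → T` is a homomorphism of coalgebras. If a bilinear map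
`A ⊗ A' → B` is a homomorphism of coalgebras, so is the algebra homomorphism `T → B` that it
determines, since `T` is generated by the image of `A ⊗ A'` (`HopfTensor.algHom_ext`).
-/

noncomputable section

namespace AbTensor

/-! ### Convolution of algebra homomorphisms -/

section Convolution

open scoped TensorProduct
open Algebra.TensorProduct (includeLeft includeRight)
open Bialgebra (comulAlgHom counitAlgHom)

universe w₁ w₂ w₃ w₄ w₅

variable {k : Type w₁} [CommRing k]

/-- `Algebra.TensorProduct.lift` for commutative targets. -/
abbrev copair {A : Type w₂} {B : Type w₃} {X : Type w₄} [CommRing A] [CommRing B] [CommRing X]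
    [Algebra k A] [Algebra k B] [Algebra k X] (f : A →ₐ[k] X) (g : B →ₐ[k] X) : A ⊗[k] B →ₐ[k] X :=
  Algebra.TensorProduct.lift f g fun _ _ ↦ .all _ _

theorem comp_copair {A : Type w₂} {B : Type w₃} {X : Type w₄} {Y : Type w₅} [CommRing A]
    [CommRing B] [CommRing X] [CommRing Y] [Algebra k A] [Algebra k B] [Algebra k X] [Algebra k Y]
    (h : X →ₐ[k] Y) (f : A →ₐ[k] X) (g : B →ₐ[k] X) :
    h.comp (copair f g) = copair (h.comp f) (h.comp g) := by
  ext <;> simp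

variable {B : Type w₂} [CommRing B] [Bialgebra k B] {X : Type w₃} [CommRing X] [Algebra k X]
  {Y : Type w₄} [CommRing Y] [Algebra k Y]

/-- The convolution product of algebra homomorphisms from a bialgebra to a commutative algebra: the
product in the monoid of `X`-valued points of `Spec B`. -/
def conv (f g : B →ₐ[k] X) : B →ₐ[k] X := (WithConv.toConv f * WithConv.toConv g).ofConv

local infixl:70 " ⋇ " => conv

variable (k B X) in
/-- The neutral element for convolution. -/
def convUnit : B →ₐ[k] X := (Algebra.ofId k X).comp (counitAlgHom k B)

theorem conv_assoc (f g h : B →ₐ[k] X) : f ⋇ g ⋇ h = f ⋇ (g ⋇ h) :=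
  congrArg WithConv.ofConv (mul_assoc (WithConv.toConv f) (WithConv.toConv g) (WithConv.toConv h))

theorem convUnit_conv (f : B →ₐ[k] X) : convUnit k B X ⋇ f = f :=
  congrArg WithConv.ofConv (one_mul (WithConv.toConv f))

theorem conv_convUnit (f : B →ₐ[k] X) : f ⋇ convUnit k B X = f :=
  congrArg WithConv.ofConv (mul_one (WithConv.toConv f))

theorem conv_comm [Coalgebra.IsCocomm k B] (f g : B →ₐ[k] X) : f ⋇ g = g ⋇ f :=
  congrArg WithConv.ofConv (mul_comm (WithConv.toConv f) (WithConv.toConv g))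

theorem comp_conv (h : X →ₐ[k] Y) (f g : B →ₐ[k] X) : h.comp (f ⋇ g) = h.comp f ⋇ h.comp g :=
  AlgHom.comp_convMul_distrib h (WithConv.toConv f) (WithConv.toConv g)

theorem comp_convUnit (h : X →ₐ[k] Y) : h.comp (convUnit k B X) = convUnit k B Y := by
  ext; simp [convUnit]

theorem conv_eq (f g : B →ₐ[k] X) : f ⋇ g = (copair f g).comp (comulAlgHom k B) := by
  ext x; exact AlgHom.convMul_apply _ _ x

theorem conv_comp {C : Type w₅} [CommRing C] [Bialgebra k C] (f g : B →ₐ[k] X) (h : C →ₐ[k] B)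
    (hh : (Algebra.TensorProduct.map h h).comp (comulAlgHom k C) = (comulAlgHom k B).comp h) :
    (f ⋇ g).comp h = f.comp h ⋇ g.comp h := by
  rw [conv_eq, conv_eq, AlgHom.comp_assoc, ← hh, ← AlgHom.comp_assoc]
  congr 1
  ext <;> simp

theorem includeLeft_conv_includeRight {X : Type w₃} {Y : Type w₄} [CommRing X] [CommRing Y]
    [Algebra k X] [Algebra k Y] (f : B →ₐ[k] X) (g : B →ₐ[k] Y) :
    (includeLeft : X →ₐ[k] X ⊗[k] Y).comp f ⋇ (includeRight : Y →ₐ[k] X ⊗[k] Y).comp g =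
      (Algebra.TensorProduct.map f g).comp (comulAlgHom k B) := by
  rw [conv_eq]
  congr 1
  ext <;> simp

theorem copair_conv_copair {C : Type w₅} [CommRing C] [Bialgebra k C] (f f' : B →ₐ[k] X)
    (g g' : C →ₐ[k] X) : copair f g ⋇ copair f' g' = copair (f ⋇ f') (g ⋇ g') := by
  have h (f : B →ₐ[k] X) (g : C →ₐ[k] X) :
      copair f g = (Algebra.TensorProduct.lmul' k).comp (Algebra.TensorProduct.map f g) := by
    ext <;> simp
  have key : Algebra.TensorProduct.map f g ⋇ Algebra.TensorProduct.map f' g' =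
      Algebra.TensorProduct.map (f ⋇ f') (g ⋇ g') := by
    apply AlgHom.toLinearMap_injective
    exact congrArg WithConv.ofConv (TensorProduct.map_convMul_map
      (f := WithConv.toConv f.toLinearMap) (h := WithConv.toConv f'.toLinearMap)
      (g := WithConv.toConv g.toLinearMap) (k := WithConv.toConv g'.toLinearMap))
  rw [h, h, h, ← comp_conv, key]

theorem copair_convUnit {C : Type w₅} [CommRing C] [Bialgebra k C] :
    copair (convUnit k B X) (convUnit k C X) = convUnit k (B ⊗[k] C) X := by
  ext <;> simp [convUnit]

end Convolution

local infixl:70 " ⋇ " => conv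

section Antipode

open scoped TensorProduct
open HopfAlgebra (antipodeAlgHom)

universe w₁ w₂ w₃

variable {k : Type w₁} [CommRing k] {B : Type w₂} [CommRing B] [HopfAlgebra k B]
  {X : Type w₃} [CommRing X] [Algebra k X]

theorem comp_antipode_conv_self (f : B →ₐ[k] X) :
    f.comp (antipodeAlgHom k B) ⋇ f = convUnit k B X := by
  have h : antipodeAlgHom k B ⋇ AlgHom.id k B = convUnit k B B :=
    congrArg WithConv.ofConv (AlgHom.antipode_id_cancel (R := k) (A := B))
  have h' := congrArg f.comp h
  rwa [comp_conv, comp_convUnit, AlgHom.comp_id] at h'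

theorem self_conv_comp_antipode [Coalgebra.IsCocomm k B] (f : B →ₐ[k] X) :
    f ⋇ f.comp (antipodeAlgHom k B) = convUnit k B X := by
  rw [conv_comm, comp_antipode_conv_self]

theorem eq_comp_antipode_of_conv_eq_convUnit [Coalgebra.IsCocomm k B] {f g : B →ₐ[k] X}
    (h : f ⋇ g = convUnit k B X) : f = g.comp (antipodeAlgHom k B) := by
  rw [← conv_convUnit f, ← self_conv_comp_antipode g, ← conv_assoc, h, convUnit_conv]

theorem eq_convUnit_of_conv_self {f : B →ₐ[k] X} (h : f ⋇ f = f) : f = convUnit k B X := by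
  rw [← comp_antipode_conv_self f]
  nth_rw 3 [← h]
  rw [← conv_assoc, comp_antipode_conv_self, convUnit_conv]

end Antipode

/-! ### Bilinear algebra homomorphisms -/

section Bilinear

open scoped TensorProduct
open Algebra.TensorProduct (includeLeft includeRight)
open Bialgebra (comulAlgHom counitAlgHom)
open HopfAlgebra (antipodeAlgHom)

variable {k : Type u} [Field k] {A A' : Type u} [CommRing A] [HopfAlgebra k A] [CommRing A']
  [HopfAlgebra k A']

/-- An algebra homomorphism `b : B → A ⊗ A'` is bilinear if the morphism
`Spec A × Spec A' → Spec B` is, that is, if `(f, g) ↦ (f, g) ∘ b` is bilinear on points with values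
in every commutative algebra `X`. -/
structure IsBilinearAlgHom {B : Type u} [CommRing B] [Bialgebra k B] (b : B →ₐ[k] A ⊗[k] A') :
    Prop where
  conv_left : ∀ (X : Type u) [CommRing X] [Algebra k X] (f₁ f₂ : A →ₐ[k] X) (g : A' →ₐ[k] X),
    (copair (f₁ ⋇ f₂) g).comp b = (copair f₁ g).comp b ⋇ (copair f₂ g).comp b
  conv_right : ∀ (X : Type u) [CommRing X] [Algebra k X] (f : A →ₐ[k] X) (g₁ g₂ : A' →ₐ[k] X),
    (copair f (g₁ ⋇ g₂)).comp b = (copair f g₁).comp b ⋇ (copair f g₂).comp b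

/-- Inversion in the first factor corresponds to inversion in the target: `b(-x, y) = -b(x, y)`. -/
theorem IsBilinearAlgHom.map_antipode_comp {B : Type u} [CommRing B] [HopfAlgebra k B]
    [Coalgebra.IsCocomm k B] {b : B →ₐ[k] A ⊗[k] A'} (hb : IsBilinearAlgHom b) :
    (Algebra.TensorProduct.map (antipodeAlgHom k A) (AlgHom.id k A')).comp b =
      b.comp (antipodeAlgHom k B) := by
  have h₀ : (copair (convUnit k A (A ⊗[k] A')) includeRight).comp b =
      convUnit k B (A ⊗[k] A') := by
    apply eq_convUnit_of_conv_self
    rw [← hb.conv_left, convUnit_conv]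
  have h₁ : copair (includeLeft : A →ₐ[k] A ⊗[k] A') includeRight = AlgHom.id k _ := by
    ext <;> simp
  have h₂ := hb.conv_left _ ((includeLeft : A →ₐ[k] A ⊗[k] A').comp (antipodeAlgHom k A))
    includeLeft includeRight
  rw [comp_antipode_conv_self, h₀, h₁, AlgHom.id_comp] at h₂
  have h₃ : copair ((includeLeft : A →ₐ[k] A ⊗[k] A').comp (antipodeAlgHom k A)) includeRight =
      Algebra.TensorProduct.map (antipodeAlgHom k A) (AlgHom.id k A') := by
    ext <;> simp
  rw [← h₃]
  exact eq_comp_antipode_of_conv_eq_convUnit h₂.symm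

/-- The sum of a bilinear `b : Spec A × Spec A' → Spec B` and a bilinear
`c : Spec A × Spec A' → Spec C`, with values in `Spec B × Spec C`. -/
theorem IsBilinearAlgHom.copair {B C : Type u} [CommRing B] [Bialgebra k B] [CommRing C]
    [Bialgebra k C] {b : B →ₐ[k] A ⊗[k] A'} {c : C →ₐ[k] A ⊗[k] A'} (hb : IsBilinearAlgHom b)
    (hc : IsBilinearAlgHom c) : IsBilinearAlgHom (copair b c) where
  conv_left X _ _ f₁ f₂ g := by
    simp only [comp_copair, hb.conv_left, hc.conv_left, copair_conv_copair]
  conv_right X _ _ f g₁ g₂ := by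
    simp only [comp_copair, hb.conv_right, hc.conv_right, copair_conv_copair]

variable (k A A') in
theorem isBilinearAlgHom_ofId : IsBilinearAlgHom (Algebra.ofId k (A ⊗[k] A')) where
  conv_left _ _ _ _ _ _ := Subsingleton.elim _ _
  conv_right _ _ _ _ _ _ := Subsingleton.elim _ _

end Bilinear

/-! ### Powers of a commutative algebra -/

section Powers

open scoped TensorProduct
open Algebra.TensorProduct (includeLeft includeRight)
open Bialgebra (comulAlgHom counitAlgHom)

variable (k : Type u) [Field k] (R : Type u) [CommRing R] [Algebra k R]

/-- The tensor power `R ⊗ (R ⊗ (⋯ ⊗ k))`, the algebra of functions on `(Spec R)ⁿ`. -/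
def tpow : ℕ → CommAlgCat.{u} k
  | 0 => .of k k
  | n + 1 => .of k (R ⊗[k] tpow n)

/-- There are no coordinates on `(Spec R)⁰`. -/
def tpowZero (X : Type u) [CommRing X] [Algebra k X] : tpow k R 0 →ₐ[k] X :=
  Algebra.ofId k X

/-- The coordinate in front. -/
def tpowHead (n : ℕ) : R →ₐ[k] tpow k R (n + 1) :=
  (includeLeft : R →ₐ[k] R ⊗[k] tpow k R n)

/-- The coordinates other than the one in front. -/
def tpowTail (n : ℕ) : tpow k R n →ₐ[k] tpow k R (n + 1) :=
  (includeRight : tpow k R n →ₐ[k] R ⊗[k] tpow k R n)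

variable {k R}

/-- The map `Spec X → (Spec R)ⁿ⁺¹` whose coordinate in front is `f` and whose other coordinates
are `g`. -/
def tpowLift {n : ℕ} {X : Type u} [CommRing X] [Algebra k X] (f : R →ₐ[k] X)
    (g : tpow k R n →ₐ[k] X) : tpow k R (n + 1) →ₐ[k] X :=
  (copair f g : R ⊗[k] tpow k R n →ₐ[k] X)

section

variable {n : ℕ} {X : Type u} [CommRing X] [Algebra k X] (f : R →ₐ[k] X) (g : tpow k R n →ₐ[k] X)

@[simp]
theorem tpowLift_comp_tpowHead : (tpowLift f g).comp (tpowHead k R n) = f :=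
  Algebra.TensorProduct.lift_comp_includeLeft _ _ fun _ _ ↦ .all _ _

@[simp]
theorem tpowLift_comp_tpowTail : (tpowLift f g).comp (tpowTail k R n) = g :=
  Algebra.TensorProduct.lift_comp_includeRight _ _ fun _ _ ↦ .all _ _

end

/-- The two parts of a tuple of `m + n` coordinates, as a map `(Spec R)ⁿ × (Spec R)ᵐ →
(Spec R)ᵐ⁺ⁿ`. -/
def tpowSplit (m : ℕ) : ∀ n : ℕ, tpow k R (m + n) →ₐ[k] tpow k R n ⊗[k] tpow k R m
  | 0 => includeRight
  | n + 1 => tpowLift (n := m + n) (includeLeft.comp (tpowHead k R n))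
      ((Algebra.TensorProduct.map (tpowTail k R n) (AlgHom.id k _)).comp (tpowSplit m n))

/-- The map induced by an endomorphism of `R`. -/
def tpowMap (s : R →ₐ[k] R) : ∀ n : ℕ, tpow k R n →ₐ[k] tpow k R n
  | 0 => AlgHom.id k _
  | n + 1 => tpowLift ((tpowHead k R n).comp s) ((tpowTail k R n).comp (tpowMap s n))

/-- For `b : Spec R → Spec B`, the map `(Spec R)ⁿ → Spec B` sending a tuple of points to the sum
of their images under `b`. -/
def powSum {B : Type u} [CommRing B] [Bialgebra k B] (b : B →ₐ[k] R) :
    ∀ n : ℕ, B →ₐ[k] tpow k R n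
  | 0 => counitAlgHom k B
  | n + 1 => (tpowHead k R n).comp b ⋇ (tpowTail k R n).comp (powSum b n)

theorem algHom_comp_tpow_zero {B : Type u} [CommRing B] [Bialgebra k B] {X : Type u} [CommRing X]
    [Algebra k X] (b : B →ₐ[k] R) (f : tpow k R 0 →ₐ[k] X) :
    f.comp (powSum b 0) = convUnit k B X := by
  ext x
  exact f.commutes _

/-- The sum over `m + n` coordinates is the sum over `n` of them plus the sum over the other `m`:
this relates the comultiplication of `B` to the splitting of tuples, which does not involve `B`. -/
theorem tpowSplit_comp_powSum {B : Type u} [CommRing B] [Bialgebra k B] (b : B →ₐ[k] R)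
    (m n : ℕ) : (tpowSplit m n).comp (powSum b (m + n)) =
      (Algebra.TensorProduct.map (powSum b n) (powSum b m)).comp (comulAlgHom k B) := by
  induction n with
  | zero =>
    rw [← includeLeft_conv_includeRight, algHom_comp_tpow_zero, convUnit_conv]
    rfl
  | succ n ih =>
    change (tpowLift (n := m + n) _ _).comp ((tpowHead k R (m + n)).comp b ⋇
      (tpowTail k R (m + n)).comp (powSum b (m + n))) = _
    rw [comp_conv, ← AlgHom.comp_assoc, ← AlgHom.comp_assoc, tpowLift_comp_tpowHead,
      tpowLift_comp_tpowTail, AlgHom.comp_assoc _ (tpowSplit m n), ih,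
      ← includeLeft_conv_includeRight, ← includeLeft_conv_includeRight, comp_conv, ← conv_assoc,
      powSum, comp_conv]
    rfl

theorem tpowMap_comp_powSum {B : Type u} [CommRing B] [Bialgebra k B] (b : B →ₐ[k] R)
    (s : R →ₐ[k] R) (n : ℕ) :
    (tpowMap s n).comp (powSum b n) = powSum (s.comp b) n := by
  induction n with
  | zero => rfl
  | succ n ih =>
    rw [tpowMap, powSum, comp_conv, ← AlgHom.comp_assoc, ← AlgHom.comp_assoc,
      tpowLift_comp_tpowHead, tpowLift_comp_tpowTail, AlgHom.comp_assoc _ (tpowMap s n), ih]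
    rfl

/-- A homomorphism of groups commutes with sums. -/
theorem powSum_comp {B C : Type u} [CommRing B] [Bialgebra k B] [CommRing C] [Bialgebra k C]
    (b : B →ₐ[k] R) (h : C →ₐ[k] B) (hε : (counitAlgHom k B).comp h = counitAlgHom k C)
    (hΔ : (Algebra.TensorProduct.map h h).comp (comulAlgHom k C) = (comulAlgHom k B).comp h)
    (n : ℕ) : (powSum b n).comp h = powSum (b.comp h) n := by
  induction n with
  | zero => exact hε
  | succ n ih => rw [powSum, conv_comp _ _ _ hΔ, AlgHom.comp_assoc, AlgHom.comp_assoc, ih, powSum]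

theorem powSum_copair {B C : Type u} [CommRing B] [Bialgebra k B] [CommRing C] [Bialgebra k C]
    (b : B →ₐ[k] R) (c : C →ₐ[k] R) (n : ℕ) :
    powSum (copair b c) n = copair (powSum b n) (powSum c n) := by
  induction n with
  | zero => exact (copair_convUnit (k := k) (X := k)).symm
  | succ n ih =>
    rw [powSum, ih, comp_copair, comp_copair, copair_conv_copair, powSum, powSum]

end Powers

/-! ### Jointly injective families -/

section Separation

open scoped TensorProduct

universe w₁ w₂ w₃ w₄ w₅ w₆ w₇

variable {k : Type w₁} [Field k] {V : Type w₂} {W : Type w₃} [AddCommGroup V] [Module k V]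
  [AddCommGroup W] [Module k W]

/-- Over a field, a jointly injective family of linear maps stays so after tensoring, even if the
family is infinite. -/
theorem eq_zero_of_forall_rTensor_eq_zero {ι : Type w₄} {V' : ι → Type w₅}
    [∀ i, AddCommGroup (V' i)] [∀ i, Module k (V' i)] (f : ∀ i, V →ₗ[k] V' i)
    (hf : ∀ v, (∀ i, f i v = 0) → v = 0) (z : V ⊗[k] W)
    (hz : ∀ i, (f i).rTensor W z = 0) : z = 0 := by
  classical
  let e := Module.Basis.ofVectorSpace k W
  apply (TensorProduct.equivFinsuppOfBasisRight e).injective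
  rw [map_zero]
  ext j
  apply hf
  intro i
  have key (z : V ⊗[k] W) : f i (TensorProduct.equivFinsuppOfBasisRight e z j) =
      TensorProduct.equivFinsuppOfBasisRight e ((f i).rTensor W z) j := by
    induction z with
    | zero => simp
    | add x y hx hy => simp [hx, hy]
    | tmul v w => simp
  rw [key, hz, map_zero, Finsupp.zero_apply]

theorem eq_zero_of_forall_map_eq_zero {ι : Type w₄} {V' : ι → Type w₅}
    [∀ i, AddCommGroup (V' i)] [∀ i, Module k (V' i)] (f : ∀ i, V →ₗ[k] V' i)
    (hf : ∀ v, (∀ i, f i v = 0) → v = 0) {κ : Type w₆} {W' : κ → Type w₇}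
    [∀ j, AddCommGroup (W' j)] [∀ j, Module k (W' j)] (g : ∀ j, W →ₗ[k] W' j)
    (hg : ∀ w, (∀ j, g j w = 0) → w = 0) (z : V ⊗[k] W)
    (hz : ∀ i j, TensorProduct.map (f i) (g j) z = 0) : z = 0 := by
  refine eq_zero_of_forall_rTensor_eq_zero f hf z fun i ↦ ?_
  apply (TensorProduct.comm k _ _).injective
  rw [map_zero]
  refine eq_zero_of_forall_rTensor_eq_zero g hg _ fun j ↦ ?_
  have key : (g j).rTensor (V' i) ∘ₗ (TensorProduct.comm k _ _).toLinearMap ∘ₗ (f i).rTensor W =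
      (TensorProduct.comm k _ _).toLinearMap ∘ₗ TensorProduct.map (f i) (g j) := by
    ext; simp
  exact (LinearMap.congr_fun key z).trans ((congrArg _ (hz i j)).trans (map_zero _))

/-- A homomorphism lifts through an injective one if its values do. -/
theorem exists_algHom_comp_eq {A : Type w₂} {B : Type w₃} {C : Type w₄} [CommRing A] [CommRing B]
    [CommRing C] [Algebra k A] [Algebra k B] [Algebra k C] (f : A →ₐ[k] C) (g : B →ₐ[k] C)
    (hg : Function.Injective g) (h : ∀ x, ∃ y, g y = f x) : ∃ φ : A →ₐ[k] B, g.comp φ = f := by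
  refine ⟨(AlgEquiv.ofInjective g hg).symm.toAlgHom.comp (f.codRestrict g.range h), ?_⟩
  ext x
  exact congrArg Subtype.val ((AlgEquiv.ofInjective g hg).apply_symm_apply _)

end Separation

/-! ### Coalgebra identities on an image -/

section CoalgebraImage

open scoped TensorProduct
open Coalgebra (comul counit)

universe w₁ w₂ w₃

variable {k : Type w₁} [CommRing k] {C : Type w₂} {T : Type w₃} [AddCommGroup C] [Module k C]
  [Coalgebra k C] [AddCommGroup T] [Module k T] {Δ : T →ₗ[k] T ⊗[k] T} {ε : T →ₗ[k] k}
  {ι : C →ₗ[k] T}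

/-- Coassociativity of `Δ` on the image of a coalgebra `C` under a map `ι` compatible with `Δ`. It
extends to the algebra generated by the image if `Δ` is an algebra homomorphism. -/
theorem coassoc_of_comp_eq (h : Δ ∘ₗ ι = TensorProduct.map ι ι ∘ₗ comul) (c : C) :
    TensorProduct.assoc k T T T (TensorProduct.map Δ LinearMap.id (Δ (ι c))) =
      TensorProduct.map LinearMap.id Δ (Δ (ι c)) := by
  have hc : Δ (ι c) = TensorProduct.map ι ι (comul c) := LinearMap.congr_fun h c
  have hL : TensorProduct.map Δ LinearMap.id ∘ₗ TensorProduct.map ι ι =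
      TensorProduct.map (TensorProduct.map ι ι) ι ∘ₗ comul.rTensor C := by
    rw [← TensorProduct.map_comp, h, LinearMap.rTensor, ← TensorProduct.map_comp]
    rfl
  have hR : TensorProduct.map LinearMap.id Δ ∘ₗ TensorProduct.map ι ι =
      TensorProduct.map ι (TensorProduct.map ι ι) ∘ₗ comul.lTensor C := by
    rw [← TensorProduct.map_comp, h, LinearMap.lTensor, ← TensorProduct.map_comp]
    rfl
  rw [hc, ← LinearMap.comp_apply, hL, ← LinearMap.comp_apply (TensorProduct.map LinearMap.id Δ),
    hR, LinearMap.comp_apply, LinearMap.comp_apply, ← Coalgebra.coassoc_apply]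
  exact LinearMap.congr_fun (TensorProduct.map_map_comp_assoc_eq ι ι ι).symm _

theorem rTensor_counit_of_comp_eq (h : Δ ∘ₗ ι = TensorProduct.map ι ι ∘ₗ comul)
    (hε : ε ∘ₗ ι = counit) (c : C) :
    TensorProduct.map ε LinearMap.id (Δ (ι c)) = 1 ⊗ₜ[k] ι c := by
  have hc : Δ (ι c) = TensorProduct.map ι ι (comul c) := LinearMap.congr_fun h c
  have hL : TensorProduct.map ε LinearMap.id ∘ₗ TensorProduct.map ι ι =
      ι.lTensor k ∘ₗ counit.rTensor C := by
    rw [← TensorProduct.map_comp, hε, LinearMap.lTensor_comp_rTensor]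
    rfl
  rw [hc, ← LinearMap.comp_apply, hL, LinearMap.comp_apply, Coalgebra.rTensor_counit_comul,
    LinearMap.lTensor_tmul]

theorem lTensor_counit_of_comp_eq (h : Δ ∘ₗ ι = TensorProduct.map ι ι ∘ₗ comul)
    (hε : ε ∘ₗ ι = counit) (c : C) :
    TensorProduct.map LinearMap.id ε (Δ (ι c)) = ι c ⊗ₜ[k] 1 := by
  have hc : Δ (ι c) = TensorProduct.map ι ι (comul c) := LinearMap.congr_fun h c
  have hL : TensorProduct.map LinearMap.id ε ∘ₗ TensorProduct.map ι ι =
      ι.rTensor k ∘ₗ counit.lTensor C := by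
    rw [← TensorProduct.map_comp, hε, LinearMap.rTensor_comp_lTensor]
    rfl
  rw [hc, ← LinearMap.comp_apply, hL, LinearMap.comp_apply, Coalgebra.lTensor_counit_comul,
    LinearMap.rTensor_tmul]

theorem comm_of_comp_eq [Coalgebra.IsCocomm k C]
    (h : Δ ∘ₗ ι = TensorProduct.map ι ι ∘ₗ comul) (c : C) :
    TensorProduct.comm k T T (Δ (ι c)) = Δ (ι c) := by
  have hc : Δ (ι c) = TensorProduct.map ι ι (comul c) := LinearMap.congr_fun h c
  rw [hc, ← TensorProduct.map_comm, Coalgebra.comm_comul]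

end CoalgebraImage

/-! ### The universal bilinear algebra homomorphism -/

section Universal

open scoped TensorProduct
open Algebra.TensorProduct (includeLeft includeRight)
open Bialgebra (comulAlgHom counitAlgHom)
open HopfAlgebra (antipodeAlgHom)

variable (k : Type u) [Field k] (A A' : Type u) [CommRing A] [HopfAlgebra k A] [CommRing A']
  [HopfAlgebra k A']

/-- An abelian Hopf algebra `B` with a bilinear morphism `Spec A × Spec A' → Spec B`. -/
structure BilinearTarget where
  carrier : Type u
  [commRing : CommRing carrier]
  [hopfAlgebra : HopfAlgebra k carrier]
  [isCocomm : Coalgebra.IsCocomm k carrier]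
  hom : carrier →ₐ[k] A ⊗[k] A'
  isBilinear : IsBilinearAlgHom hom

attribute [instance] BilinearTarget.commRing BilinearTarget.hopfAlgebra BilinearTarget.isCocomm

variable {k A A'}

namespace BilinearTarget

/-- The sum of two bilinear morphisms, with values in the product. -/
def prod (P Q : BilinearTarget k A A') : BilinearTarget k A A' where
  carrier := P.carrier ⊗[k] Q.carrier
  hom := copair P.hom Q.hom
  isBilinear := P.isBilinear.copair Q.isBilinear

variable (k A A') in
/-- The zero morphism to the trivial group. -/
def unit : BilinearTarget k A A' where
  carrier := k
  hom := Algebra.ofId k _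
  isBilinear := isBilinearAlgHom_ofId k A A'

/-- A function on the target, as the sequence of functions on `(Spec A × Spec A')ⁿ` that it induces
by summation of values. -/
def seq (P : BilinearTarget k A A') : P.carrier →ₐ[k] ∀ n, tpow k (A ⊗[k] A') n :=
  AlgHom.pi (powSum P.hom)

theorem seq_prod_tmul (P Q : BilinearTarget k A A') (x : P.carrier) (y : Q.carrier) :
    (P.prod Q).seq (x ⊗ₜ[k] y) = P.seq x * Q.seq y := by
  ext n
  exact (AlgHom.congr_fun (powSum_copair P.hom Q.hom n) _).trans
    (Algebra.TensorProduct.lift_tmul _ _ _ _ _)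

end BilinearTarget

variable (k A A') in
/-- The sequences of functions on `(Spec A × Spec A')ⁿ`, for `n ≥ 0`, that come from a function on
the target of some bilinear morphism. -/
def tensorSubalgebra : Subalgebra k (∀ n, tpow k (A ⊗[k] A') n) where
  carrier := {f | ∃ (P : BilinearTarget k A A') (x : P.carrier), P.seq x = f}
  mul_mem' := by
    rintro _ _ ⟨P, x, rfl⟩ ⟨Q, y, rfl⟩
    exact ⟨P.prod Q, x ⊗ₜ y, P.seq_prod_tmul Q x y⟩
  add_mem' := by
    rintro _ _ ⟨P, x, rfl⟩ ⟨Q, y, rfl⟩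
    refine ⟨P.prod Q, x ⊗ₜ 1 + 1 ⊗ₜ y, ?_⟩
    refine ((P.prod Q).seq.map_add (x ⊗ₜ 1) (1 ⊗ₜ y)).trans
      ((congrArg₂ _ (P.seq_prod_tmul Q x 1) (P.seq_prod_tmul Q 1 y)).trans ?_)
    rw [map_one, map_one, mul_one, one_mul]
  algebraMap_mem' r :=
    ⟨.unit k A A', algebraMap k k r, (BilinearTarget.unit k A A').seq.commutes r⟩

variable (k A A') in
/-- The algebra of functions on the tensor product of `Spec A` and `Spec A'`. -/
def TensorAlg : Type u := tensorSubalgebra k A A'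

namespace TensorAlg

instance : CommRing (TensorAlg k A A') := inferInstanceAs (CommRing (tensorSubalgebra k A A'))

instance : Algebra k (TensorAlg k A A') :=
  inferInstanceAs (Algebra k (tensorSubalgebra k A A'))

variable (k A A') in
/-- The terms of a sequence. -/
def term (n : ℕ) : TensorAlg k A A' →ₐ[k] tpow k (A ⊗[k] A') n :=
  (Pi.evalAlgHom k _ n).comp (tensorSubalgebra k A A').val

theorem ext_term {x y : TensorAlg k A A'} (h : ∀ n, term k A A' n x = term k A A' n y) : x = y :=
  Subtype.ext (funext h)

/-- The homomorphism that corresponds to a bilinear morphism. -/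
def ofTarget (P : BilinearTarget k A A') : P.carrier →ₐ[k] TensorAlg k A A' :=
  P.seq.codRestrict (tensorSubalgebra k A A') fun x ↦ ⟨P, x, rfl⟩

theorem exists_ofTarget_eq (f : TensorAlg k A A') :
    ∃ (P : BilinearTarget k A A') (x : P.carrier), ofTarget P x = f :=
  let ⟨P, x, h⟩ := f.2
  ⟨P, x, Subtype.ext h⟩

@[simp]
theorem term_comp_ofTarget (P : BilinearTarget k A A') (n : ℕ) :
    (term k A A' n).comp (ofTarget P) = powSum P.hom n := rfl

theorem algHom_ext {X : Type u} [CommRing X] [Algebra k X] {f g : TensorAlg k A A' →ₐ[k] X}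
    (h : ∀ P, f.comp (ofTarget P) = g.comp (ofTarget P)) : f = g := by
  ext x
  obtain ⟨P, x, rfl⟩ := exists_ofTarget_eq x
  exact AlgHom.congr_fun (h P) x

/-- The pairs of terms separate the elements of `T ⊗ T`. -/
theorem tensor_ext {x y : TensorAlg k A A' ⊗[k] TensorAlg k A A'}
    (h : ∀ n m, Algebra.TensorProduct.map (term k A A' n) (term k A A' m) x =
      Algebra.TensorProduct.map (term k A A' n) (term k A A' m) y) : x = y := by
  rw [← sub_eq_zero]
  have hterm (v : TensorAlg k A A') (hv : ∀ n, (term k A A' n).toLinearMap v = 0) : v = 0 :=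
    ext_term fun n ↦ (hv n).trans (map_zero _).symm
  refine eq_zero_of_forall_map_eq_zero (fun n ↦ (term k A A' n).toLinearMap) hterm
    (fun n ↦ (term k A A' n).toLinearMap) hterm _ fun n m ↦ ?_
  rw [map_sub, sub_eq_zero]
  exact h n m

variable (k A A') in
/-- Splitting the terms of a sequence descends to a comultiplication, since it does so for the
sequences that come from a function on a group. -/
theorem exists_comul : ∃ Δ : TensorAlg k A A' →ₐ[k] TensorAlg k A A' ⊗[k] TensorAlg k A A',
    ∀ P, Δ.comp (ofTarget P) =
      (Algebra.TensorProduct.map (ofTarget P) (ofTarget P)).comp (comulAlgHom k P.carrier) := by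
  let Ψ : TensorAlg k A A' ⊗[k] TensorAlg k A A' →ₐ[k]
      ∀ p : ℕ × ℕ, tpow k (A ⊗[k] A') p.1 ⊗[k] tpow k (A ⊗[k] A') p.2 :=
    AlgHom.pi fun p ↦ Algebra.TensorProduct.map (term k A A' p.1) (term k A A' p.2)
  let Φ : TensorAlg k A A' →ₐ[k]
      ∀ p : ℕ × ℕ, tpow k (A ⊗[k] A') p.1 ⊗[k] tpow k (A ⊗[k] A') p.2 :=
    AlgHom.pi fun p ↦ (tpowSplit p.2 p.1).comp (term k A A' (p.2 + p.1))
  have hΨ : Function.Injective Ψ := fun x y h ↦ tensor_ext fun n m ↦ congrFun h (n, m)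
  have key (P : BilinearTarget k A A') : Ψ.comp ((Algebra.TensorProduct.map (ofTarget P)
      (ofTarget P)).comp (comulAlgHom k P.carrier)) = Φ.comp (ofTarget P) := by
    ext x p
    have h := AlgHom.congr_fun (tpowSplit_comp_powSum P.hom p.2 p.1) x
    rw [← term_comp_ofTarget, ← term_comp_ofTarget, ← term_comp_ofTarget,
      Algebra.TensorProduct.map_comp] at h
    exact h.symm
  obtain ⟨Δ, hΔ⟩ := exists_algHom_comp_eq Φ Ψ hΨ fun f ↦ by
    obtain ⟨P, x, rfl⟩ := exists_ofTarget_eq f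
    exact ⟨_, AlgHom.congr_fun (key P) x⟩
  refine ⟨Δ, fun P ↦ ?_⟩
  ext x
  apply hΨ
  exact (AlgHom.congr_fun hΔ (ofTarget P x)).trans (AlgHom.congr_fun (key P) x).symm

variable (k A A') in
/-- Inversion on `Spec A`, applied to all the terms of a sequence, preserves the sequences that come
from a function on a group, where it is the antipode. -/
theorem exists_antipode : ∃ S : TensorAlg k A A' →ₐ[k] TensorAlg k A A',
    ∀ P, S.comp (ofTarget P) = (ofTarget P).comp (antipodeAlgHom k P.carrier) := by
  let Φ : TensorAlg k A A' →ₐ[k] ∀ n, tpow k (A ⊗[k] A') n :=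
    AlgHom.pi fun n ↦
      (tpowMap (Algebra.TensorProduct.map (antipodeAlgHom k A) (AlgHom.id k A')) n).comp
        (term k A A' n)
  have key (P : BilinearTarget k A A') : (tensorSubalgebra k A A').val.comp
      ((ofTarget P).comp (antipodeAlgHom k P.carrier)) = Φ.comp (ofTarget P) := by
    ext x n
    have h := tpowMap_comp_powSum P.hom
      (Algebra.TensorProduct.map (antipodeAlgHom k A) (AlgHom.id k A')) n
    rw [P.isBilinear.map_antipode_comp, ← powSum_comp] at h
    · exact (AlgHom.congr_fun h x).symm
    · exact AlgHom.counitAlgHom_comp_antipodeAlgHom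
    · exact AlgHom.toLinearMap_injective (AbHopf.map_antipode_comp_comul P.carrier)
  obtain ⟨S, hS⟩ := exists_algHom_comp_eq Φ (tensorSubalgebra k A A').val Subtype.val_injective
    fun f ↦ by
      obtain ⟨P, x, rfl⟩ := exists_ofTarget_eq f
      exact ⟨_, AlgHom.congr_fun (key P) x⟩
  refine ⟨S, fun P ↦ ?_⟩
  ext x
  apply Subtype.val_injective
  exact (AlgHom.congr_fun hS (ofTarget P x)).trans (AlgHom.congr_fun (key P) x).symm

instance : Bialgebra k (TensorAlg k A A') :=
  have h (P : BilinearTarget k A A') : (exists_comul k A A').choose.toLinearMap ∘ₗ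
      (ofTarget P).toLinearMap = TensorProduct.map (ofTarget P).toLinearMap
        (ofTarget P).toLinearMap ∘ₗ Coalgebra.comul :=
    congrArg AlgHom.toLinearMap ((exists_comul k A A').choose_spec P)
  have hε (P : BilinearTarget k A A') : (term k A A' 0).toLinearMap ∘ₗ
      (ofTarget P).toLinearMap = Coalgebra.counit := rfl
  .ofAlgHom (exists_comul k A A').choose (term k A A' 0)
    (algHom_ext fun P ↦ AlgHom.ext fun x ↦ coassoc_of_comp_eq (h P) x)
    (algHom_ext fun P ↦ AlgHom.ext fun x ↦ rTensor_counit_of_comp_eq (h P) (hε P) x)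
    (algHom_ext fun P ↦ AlgHom.ext fun x ↦ lTensor_counit_of_comp_eq (h P) (hε P) x)

theorem comul_comp_ofTarget (P : BilinearTarget k A A') :
    (comulAlgHom k (TensorAlg k A A')).comp (ofTarget P) =
      (Algebra.TensorProduct.map (ofTarget P) (ofTarget P)).comp (comulAlgHom k P.carrier) :=
  (exists_comul k A A').choose_spec P

theorem counit_comp_ofTarget (P : BilinearTarget k A A') :
    (counitAlgHom k (TensorAlg k A A')).comp (ofTarget P) = counitAlgHom k P.carrier := rfl

instance : Coalgebra.IsCocomm k (TensorAlg k A A') where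
  comm_comp_comul := by
    ext f
    obtain ⟨P, x, rfl⟩ := exists_ofTarget_eq f
    exact comm_of_comp_eq (Δ := Coalgebra.comul) (ι := (ofTarget P).toLinearMap)
      (congrArg AlgHom.toLinearMap (comul_comp_ofTarget P)) x

theorem conv_comp_ofTarget {X : Type u} [CommRing X] [Algebra k X]
    (f g : TensorAlg k A A' →ₐ[k] X) (P : BilinearTarget k A A') :
    (f ⋇ g).comp (ofTarget P) = f.comp (ofTarget P) ⋇ g.comp (ofTarget P) :=
  conv_comp f g _ (comul_comp_ofTarget P).symm

instance : HopfAlgebra k (TensorAlg k A A') :=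
  have hS := (exists_antipode k A A').choose_spec
  .ofAlgHom (exists_antipode k A A').choose
    (by
      refine (conv_eq _ _).symm.trans (algHom_ext fun P ↦ ?_)
      rw [conv_comp_ofTarget, hS, AlgHom.id_comp, comp_antipode_conv_self]
      rfl)
    (by
      refine (conv_eq _ _).symm.trans (algHom_ext fun P ↦ ?_)
      rw [conv_comp_ofTarget, hS, AlgHom.id_comp, self_conv_comp_antipode]
      rfl)

variable (k A A') in
/-- The universal bilinear morphism takes a sequence to its term at `n = 1`, a function on
`Spec A × Spec A'`. -/
def univ : TensorAlg k A A' →ₐ[k] A ⊗[k] A' :=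
  (tpowLift (AlgHom.id k (A ⊗[k] A')) (tpowZero k _ _)).comp (term k A A' 1)

theorem univ_comp_ofTarget (P : BilinearTarget k A A') :
    (univ k A A').comp (ofTarget P) = P.hom := by
  rw [univ, AlgHom.comp_assoc, term_comp_ofTarget, powSum, comp_conv, ← AlgHom.comp_assoc,
    ← AlgHom.comp_assoc, tpowLift_comp_tpowHead, tpowLift_comp_tpowTail, AlgHom.id_comp,
    algHom_comp_tpow_zero, conv_convUnit]

variable (k A A') in
theorem isBilinearAlgHom_univ : IsBilinearAlgHom (univ k A A') where
  conv_left X _ _ f₁ f₂ g := algHom_ext fun P ↦ by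
    rw [conv_comp_ofTarget]
    simp only [AlgHom.comp_assoc, univ_comp_ofTarget]
    exact P.isBilinear.conv_left X f₁ f₂ g
  conv_right X _ _ f g₁ g₂ := algHom_ext fun P ↦ by
    rw [conv_comp_ofTarget]
    simp only [AlgHom.comp_assoc, univ_comp_ofTarget]
    exact P.isBilinear.conv_right X f g₁ g₂

variable (k A A') in
/-- A sequence is determined by the sums of the values of the universal bilinear morphism, which
gives the uniqueness in the universal property. -/
theorem powSum_univ (n : ℕ) : powSum (univ k A A') n = term k A A' n := by
  refine algHom_ext fun P ↦ ?_
  rw [powSum_comp _ _ (counit_comp_ofTarget P) (comul_comp_ofTarget P).symm, univ_comp_ofTarget,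
    term_comp_ofTarget]

/-- The homomorphism that corresponds to a bilinear morphism, as a homomorphism of bialgebras. -/
def bialgHomOfTarget (P : BilinearTarget k A A') : P.carrier →ₐc[k] TensorAlg k A A' :=
  .ofAlgHom (ofTarget P) (counit_comp_ofTarget P) (comul_comp_ofTarget P).symm

/-- Every bilinear algebra homomorphism factors uniquely through the universal one. -/
theorem existsUnique_comp_eq {B : Type u} [CommRing B] [HopfAlgebra k B] [Coalgebra.IsCocomm k B]
    {b : B →ₐ[k] A ⊗[k] A'} (hb : IsBilinearAlgHom b) :
    ∃! φ : B →ₐc[k] TensorAlg k A A', (univ k A A').comp (φ : B →ₐ[k] TensorAlg k A A') = b := by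
  refine ⟨bialgHomOfTarget ⟨B, b, hb⟩, univ_comp_ofTarget ⟨B, b, hb⟩, fun φ hφ ↦ ?_⟩
  ext x
  refine ext_term fun n ↦ ?_
  -- The terms of the universal sequence are the sums of the values of `univ`.
  have h := powSum_comp (univ k A A') (φ : B →ₐ[k] TensorAlg k A A')
    (BialgHomClass.counitAlgHom_comp φ) (BialgHomClass.map_comp_comulAlgHom φ) n
  rw [hφ, powSum_univ] at h
  exact AlgHom.congr_fun h x

end TensorAlg

end Universal

/-! ### Transport along an equivalence -/

section Transport

open MonoidalCategory CartesianMonoidalCategory MonObj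

universe v₁ u₁ v₂ u₂

variable {C : Type u₁} [Category.{v₁} C] [CartesianMonoidalCategory C] [BraidedCategory C]
  {D : Type u₂} [Category.{v₂} D] [CartesianMonoidalCategory D] [BraidedCategory D]

theorem IsBilinear.precomp {A₁ A₂ A₁' A₂' B : CommGrp C} {b : A₂.X ⊗ A₂'.X ⟶ B.X}
    (hb : IsBilinear b) (φ : A₁ ⟶ A₂) (φ' : A₁' ⟶ A₂') :
    IsBilinear (A := A₁) (A' := A₁') ((φ.hom.hom.hom ⊗ₘ φ'.hom.hom.hom) ≫ b) where
  map_mul_left X f₁ f₂ g := by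
    simp only [lift_map_assoc, mul_comp, hb.map_mul_left]
  map_mul_right X f g₁ g₂ := by
    simp only [lift_map_assoc, mul_comp, hb.map_mul_right]

theorem IsBilinear.postcomp {A A' B₁ B₂ : CommGrp C} {b : A.X ⊗ A'.X ⟶ B₁.X}
    (hb : IsBilinear b) (φ : B₁ ⟶ B₂) : IsBilinear (B := B₂) (b ≫ φ.hom.hom.hom) where
  map_mul_left X f₁ f₂ g := by
    simp only [← Category.assoc, hb.map_mul_left, mul_comp]
  map_mul_right X f g₁ g₂ := by
    simp only [← Category.assoc, hb.map_mul_right, mul_comp]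

variable (F : C ⥤ D) [F.Braided]

theorem lift_map_comp_μ {X Y Z : C} (f : X ⟶ Y) (g : X ⟶ Z) :
    lift (F.map f) (F.map g) ≫ Functor.LaxMonoidal.μ F Y Z = F.map (lift f g) := by
  rw [← cancel_mono (Functor.OplaxMonoidal.δ F Y Z)]
  ext <;> simp

/-- A fully faithful braided functor reflects bilinearity. It preserves bilinearity if, up to
isomorphism, every test object lies in its image. -/
theorem isBilinear_map_iff [F.Full] [F.Faithful] [F.EssSurj] {A A' B : CommGrp C}
    {b : A.X ⊗ A'.X ⟶ B.X} :
    IsBilinear (A := F.mapCommGrp.obj A) (A' := F.mapCommGrp.obj A') (B := F.mapCommGrp.obj B)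
      (Functor.LaxMonoidal.μ F A.X A'.X ≫ F.map b) ↔ IsBilinear b where
  mp hb :=
    { map_mul_left X f₁ f₂ g := by
        apply F.map_injective
        have h := hb.map_mul_left (F.obj X) (F.map f₁) (F.map f₂) (F.map g)
        simp only [Functor.map_comp, ← lift_map_comp_μ, Functor.map_mul, Category.assoc]
        exact h
      map_mul_right X f g₁ g₂ := by
        apply F.map_injective
        have h := hb.map_mul_right (F.obj X) (F.map f) (F.map g₁) (F.map g₂)
        simp only [Functor.map_comp, ← lift_map_comp_μ, Functor.map_mul, Category.assoc]
        exact h }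
  mpr hb :=
    { map_mul_left X f₁ f₂ g := by
        let ε := F.objObjPreimageIso X
        obtain ⟨p₁, hp₁⟩ := F.map_surjective (ε.hom ≫ f₁)
        obtain ⟨p₂, hp₂⟩ := F.map_surjective (ε.hom ≫ f₂)
        obtain ⟨q, hq⟩ := F.map_surjective (ε.hom ≫ g)
        have h := congrArg F.map (hb.map_mul_left _ p₁ p₂ q)
        rw [← cancel_epi ε.hom]
        simp only [Functor.map_mul, Functor.map_comp, ← lift_map_comp_μ, hp₁, hp₂, hq, comp_mul,
          comp_lift_assoc, Category.assoc] at h ⊢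
        exact h
      map_mul_right X f g₁ g₂ := by
        let ε := F.objObjPreimageIso X
        obtain ⟨p, hp⟩ := F.map_surjective (ε.hom ≫ f)
        obtain ⟨q₁, hq₁⟩ := F.map_surjective (ε.hom ≫ g₁)
        obtain ⟨q₂, hq₂⟩ := F.map_surjective (ε.hom ≫ g₂)
        have h := congrArg F.map (hb.map_mul_right _ p q₁ q₂)
        rw [← cancel_epi ε.hom]
        simp only [Functor.map_mul, Functor.map_comp, ← lift_map_comp_μ, hp, hq₁, hq₂, comp_mul,
          comp_lift_assoc, Category.assoc] at h ⊢
        exact h }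

section

/-! In the two lemmas below, `b₀` is a preimage of the morphism `b` under `F`, up to the given
isomorphisms, and factorizations of `b₀` through `a` correspond to factorizations of `b` through
`F.map a`. -/

variable {E : Type u₁} [Category.{v₁} E] {E' : Type u₂} [Category.{v₂} E'] {F : E ⥤ E'}
  {Z Y T : E} {P P' Y' : E'} {κ : P ≅ P'} {ν : P ≅ F.obj Z} {δ : F.obj Y ≅ Y'} {a : Z ⟶ T}
  {b₀ : Z ⟶ Y} {b : P' ⟶ Y'}

theorem factorization_map (hb : ν.hom ≫ F.map b₀ = κ.hom ≫ b ≫ δ.inv) {φ : T ⟶ Y}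
    (hφ : a ≫ φ = b₀) : (κ.inv ≫ ν.hom ≫ F.map a) ≫ F.map φ ≫ δ.hom = b := by
  rw [Category.assoc, Category.assoc, ← Functor.map_comp_assoc, hφ, reassoc_of% hb,
    κ.inv_hom_id_assoc, δ.inv_hom_id, Category.comp_id]

theorem factorization_of_map [F.Faithful] (hb : ν.hom ≫ F.map b₀ = κ.hom ≫ b ≫ δ.inv)
    {ψ : F.obj T ⟶ Y'} {φ : T ⟶ Y} (hφ : F.map φ = ψ ≫ δ.inv)
    (hψ : (κ.inv ≫ ν.hom ≫ F.map a) ≫ ψ = b) : a ≫ φ = b₀ := by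
  apply F.map_injective
  rw [← cancel_epi ν.hom, hb, ← hψ, Functor.map_comp, hφ]
  simp

end

/-- Existence of tensor products is invariant under equivalence of categories. -/
theorem HasTensorProducts.of_equivalence (e : C ≌ D) [e.functor.Braided] [e.inverse.Braided]
    (h : HasTensorProducts (𝟭 (CommGrp C))) : HasTensorProducts (𝟭 (CommGrp D)) := by
  have hG : e.functor.mapCommGrp.EssSurj := inferInstanceAs e.mapCommGrp.functor.EssSurj
  intro A A'
  let α := e.functor.mapCommGrp.objObjPreimageIso A
  let α' := e.functor.mapCommGrp.objObjPreimageIso A'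
  let κ := (CommGrp.forget D).mapIso α ⊗ᵢ (CommGrp.forget D).mapIso α'
  obtain ⟨T, a, ha⟩ := h (e.functor.mapCommGrp.objPreimage A) (e.functor.mapCommGrp.objPreimage A')
  refine ⟨e.functor.mapCommGrp.obj T, κ.inv ≫ Functor.LaxMonoidal.μ e.functor _ _ ≫
    e.functor.map a, ((isBilinear_map_iff e.functor).2 ha.isBilinear).precomp α.inv α'.inv,
    fun B b hb ↦ ?_⟩
  let β := e.functor.mapCommGrp.objObjPreimageIso B
  let δ := (CommGrp.forget D).mapIso β
  let ν := Functor.Monoidal.μIso e.functor (e.functor.mapCommGrp.objPreimage A).X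
    (e.functor.mapCommGrp.objPreimage A').X
  obtain ⟨b₀, hb₀⟩ := e.functor.map_surjective (ν.inv ≫ κ.hom ≫ b ≫ δ.inv)
  have hb₀' := (congrArg (ν.hom ≫ ·) hb₀).trans (ν.hom_inv_id_assoc _)
  have hbil : IsBilinear b₀ := by
    rw [← isBilinear_map_iff e.functor]
    have h := (hb.postcomp β.inv).precomp α.hom α'.hom
    exact hb₀' ▸ h
  obtain ⟨φ₀, hφ₀, huniq⟩ := ha.existsUnique _ b₀ hbil
  change a ≫ φ₀.hom.hom.hom = b₀ at hφ₀
  refine ⟨e.functor.mapCommGrp.map φ₀ ≫ β.hom, factorization_map hb₀' hφ₀, fun ψ hψ ↦ ?_⟩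
  obtain ⟨ψ₀, hψ₀⟩ := e.functor.mapCommGrp.map_surjective (ψ ≫ β.inv)
  rw [← huniq ψ₀ (factorization_of_map (F := e.functor) hb₀'
    (congrArg (CommGrp.forget D).map hψ₀) hψ), hψ₀, Category.assoc, β.inv_hom_id,
    Category.comp_id]

end Transport

/-! ### Group objects in the opposite of commutative algebras -/

section OppositeAlgebras

open MonoidalCategory CartesianMonoidalCategory MonObj Opposite

variable {k : Type u} [Field k]

/-- The Hopf algebra structure on `A` is the one that Mathlib derives from the group object. -/
instance (A : (CommAlgCat.{u} k)ᵒᵖ) [GrpObj A] [IsCommMonObj A] :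
    Coalgebra.IsCocomm k A.unop where
  comm_comp_comul :=
    congrArg (fun f ↦ f.unop.hom.toLinearMap) (IsCommMonObj.mul_comm A)

theorem unop_hom_mul {X A : (CommAlgCat.{u} k)ᵒᵖ} [GrpObj A] (f g : X ⟶ A) :
    (f * g).unop.hom = f.unop.hom ⋇ g.unop.hom :=
  (conv_eq f.unop.hom g.unop.hom).symm

theorem isBilinear_iff_isBilinearAlgHom {A A' B : CommGrp (CommAlgCat.{u} k)ᵒᵖ}
    (b : A.X ⊗ A'.X ⟶ B.X) : IsBilinear b ↔ IsBilinearAlgHom b.unop.hom where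
  mp hb :=
    { conv_left X _ _ f₁ f₂ g := by
        have h := congrArg (fun f ↦ f.unop.hom) (hb.map_mul_left (op (.of k X))
          (CommAlgCat.ofHom f₁).op (CommAlgCat.ofHom f₂).op (CommAlgCat.ofHom g).op)
        simp only [unop_hom_mul] at h
        rw [unop_comp, CommAlgCat.hom_comp, CommAlgCat.lift_unop_hom, unop_hom_mul] at h
        exact h
      conv_right X _ _ f g₁ g₂ := by
        have h := congrArg (fun f ↦ f.unop.hom) (hb.map_mul_right (op (.of k X))
          (CommAlgCat.ofHom f).op (CommAlgCat.ofHom g₁).op (CommAlgCat.ofHom g₂).op)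
        simp only [unop_hom_mul] at h
        rw [unop_comp, CommAlgCat.hom_comp, CommAlgCat.lift_unop_hom, unop_hom_mul] at h
        exact h }
  mpr hb :=
    { map_mul_left X f₁ f₂ g := by
        apply Quiver.Hom.unop_inj
        apply CommAlgCat.hom_ext
        rw [unop_hom_mul, unop_comp, CommAlgCat.hom_comp, CommAlgCat.lift_unop_hom, unop_hom_mul]
        exact hb.conv_left _ _ _ _
      map_mul_right X f g₁ g₂ := by
        apply Quiver.Hom.unop_inj
        apply CommAlgCat.hom_ext
        rw [unop_hom_mul, unop_comp, CommAlgCat.hom_comp, CommAlgCat.lift_unop_hom, unop_hom_mul]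
        exact hb.conv_right _ _ _ _ }

variable (k) in
/-- The tensor product of `Spec A` and `Spec A'` is the spectrum of `TensorAlg k A A'`. -/
theorem hasTensorProducts_commAlgCat_op :
    HasTensorProducts (𝟭 (CommGrp (CommAlgCat.{u} k)ᵒᵖ)) := by
  intro (A : CommGrp _) (A' : CommGrp _)
  let T : CommGrp (CommAlgCat.{u} k)ᵒᵖ := ⟨op (.of k (TensorAlg k A.X.unop A'.X.unop))⟩
  let a : A.X ⊗ A'.X ⟶ T.X := (CommAlgCat.ofHom (TensorAlg.univ k A.X.unop A'.X.unop)).op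
  refine ⟨T, a, (isBilinear_iff_isBilinearAlgHom a).2
    (TensorAlg.isBilinearAlgHom_univ k A.X.unop A'.X.unop),
    fun (B : CommGrp _) (b : A.X ⊗ A'.X ⟶ B.X) hb ↦ ?_⟩
  obtain ⟨φ, hφ, huniq⟩ :=
    TensorAlg.existsUnique_comp_eq ((isBilinear_iff_isBilinearAlgHom b).1 hb)
  refine ⟨InducedCategory.homMk (Grp.homMk'
    { hom := (CommAlgCat.ofHom (φ : B.X.unop →ₐ[k] TensorAlg k A.X.unop A'.X.unop)).op
      isMonHom_hom :=
        { one_hom := Quiver.Hom.unop_inj (CommAlgCat.hom_ext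
            (BialgHomClass.counitAlgHom_comp φ))
          mul_hom := Quiver.Hom.unop_inj (CommAlgCat.hom_ext
            (BialgHomClass.map_comp_comulAlgHom φ).symm) } }), ?_, fun ψ hψ ↦ ?_⟩
  · exact Quiver.Hom.unop_inj (CommAlgCat.hom_ext hφ)
  · let ψ' : B.X.unop →ₐc[k] TensorAlg k A.X.unop A'.X.unop :=
      .ofAlgHom ψ.hom.hom.hom.unop.hom
        (congrArg (fun f ↦ f.unop.hom) (IsMonHom.one_hom (f := ψ.hom.hom.hom)))
        (congrArg (fun f ↦ f.unop.hom) (IsMonHom.mul_hom (f := ψ.hom.hom.hom))).symm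
    have h : ψ' = φ := huniq ψ' (congrArg (fun f ↦ f.unop.hom) hψ)
    apply CommGrp.hom_ext
    apply Quiver.Hom.unop_inj
    apply CommAlgCat.hom_ext
    exact congrArg (fun f : B.X.unop →ₐc[k] TensorAlg k A.X.unop A'.X.unop ↦
      (f : B.X.unop →ₐ[k] TensorAlg k A.X.unop A'.X.unop)) h

end OppositeAlgebras

/-! ### Affine group schemes -/

section Affine

open AlgebraicGeometry

variable (k : Type u) [Field k]

/-- The spectrum, as a functor to affine schemes over `k`. -/
def affSpec : (CommAlgCat.{u} k)ᵒᵖ ⥤ AffSch k :=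
  (isAffineOver k).lift (algSpec (CommRingCat.of k)) fun A ↦
    inferInstanceAs (IsAffine (Spec (CommRingCat.of A.unop)))

instance : (affSpec k).Full where
  map_surjective f :=
    let ⟨g, hg⟩ := (algSpec.instFull (R := CommRingCat.of k)).map_surjective f.hom
    ⟨g, ObjectProperty.hom_ext _ hg⟩

instance : (affSpec k).Faithful where
  map_injective h :=
    (algSpec.instFaithful (R := CommRingCat.of k)).map_injective (congrArg (fun f ↦ f.hom) h)

instance : (affSpec k).EssSurj where
  mem_essImage X := by
    obtain ⟨A, ⟨e⟩⟩ := (essImage_algSpec (R := CommRingCat.of k)).2 X.property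
    exact ⟨A, ⟨(isAffineOver k).isoMk e⟩⟩

instance : (affSpec k).IsEquivalence where

theorem hasTensorProducts_abSch : HasTensorProducts (𝟭 (AbSch k)) :=
  let : (affSpec k).asEquivalence.functor.Braided := .ofChosenFiniteProducts _
  let : (affSpec k).asEquivalence.inverse.Braided := .ofChosenFiniteProducts _
  .of_equivalence (affSpec k).asEquivalence (hasTensorProducts_commAlgCat_op k)

end Affine

/-! ### Bilinear linear maps -/

section Measuring

open MonoidalCategory CartesianMonoidalCategory MonObj
open WithConv (toConv)
open scoped TensorProduct

variable {k : Type u} [Field k] {A A' : AbHopf k}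

/-- The convolution algebra element given by the pullback of a linear map along a morphism of
coalgebras. -/
def pull {R : Type u} [CommRing R] [Algebra k R] {X Y : CocommCoalgCat k}
    (φ : Y.carrier →ₗ[k] R) (m : X ⟶ Y) : WithConv (X.carrier →ₗ[k] R) :=
  toConv (φ ∘ₗ m.hom.toLinearMap)

section pull

variable {R : Type u} [CommRing R] [Algebra k R] {X Y Z : CocommCoalgCat k}

theorem pull_id (φ : Y.carrier →ₗ[k] R) : pull φ (𝟙 Y) = toConv φ := rfl

theorem pull_comp (φ : Z.carrier →ₗ[k] R) (m : X ⟶ Y) (m' : Y ⟶ Z) :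
    pull φ (m ≫ m') = pull (φ ∘ₗ m'.hom.toLinearMap) m := rfl

theorem pull_mul (φ ψ : WithConv (Y.carrier →ₗ[k] R)) (m : X ⟶ Y) :
    pull (φ * ψ).ofConv m = pull φ.ofConv m * pull ψ.ofConv m :=
  congrArg toConv (LinearMap.convMul_comp_coalgHom_distrib φ ψ m.hom)

theorem pull_one (m : X ⟶ Y) : pull (1 : WithConv (Y.carrier →ₗ[k] R)).ofConv m = 1 := by
  ext x
  exact congrArg (algebraMap k R) (CoalgHomClass.counit_comp_apply m.hom x)

theorem algHom_pull_mul_pull {R' : Type u} [CommRing R'] [Algebra k R'] (h : R →ₐ[k] R')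
    (φ ψ : Y.carrier →ₗ[k] R) (m m' : X ⟶ Y) (x : X.carrier) :
    h ((pull φ m * pull ψ m') x) =
      (pull (h.toLinearMap ∘ₗ φ) m * pull (h.toLinearMap ∘ₗ ψ) m') x :=
  LinearMap.congr_fun (LinearMap.algHom_comp_convMul_distrib h (pull φ m) (pull ψ m')) x

theorem hom_ext_toConv {p q : X ⟶ Y} (h : toConv p.hom.toLinearMap = toConv q.hom.toLinearMap) :
    p = q :=
  CocommCoalgCat.hom_ext (CoalgHom.coe_linearMap_injective (WithConv.toConv_injective h))

/-- The group structure on `Hom(X, B)` is convolution. -/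
theorem toConv_mul_hom {B : AbHopf k} (p q : X ⟶ B.coalg) :
    toConv (p * q).hom.toLinearMap = toConv p.hom.toLinearMap * toConv q.hom.toLinearMap := by
  rw [Hom.mul_def, CocommCoalgCat.lift_eq]
  rfl

theorem toConv_one_hom {B : AbHopf k} : toConv (1 : X ⟶ B.coalg).hom.toLinearMap = 1 := by
  rw [Hom.one_def]
  rfl

end pull

variable (A A') in
/-- A linear map `φ : A ⊗ A' → R` to a commutative algebra is bilinear if composition with it is
compatible with the group structures on `Hom(X, A)` and `Hom(X, A')` and the convolution product of
linear maps `X → R`, for every cocommutative coalgebra `X`. As convolution is not invertible in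
general, compatibility with the neutral element of `Hom(X, A)` is part of the definition. -/
structure IsBilinearLinearMap {R : Type u} [CommRing R] [Algebra k R]
    (φ : (A.coalg ⊗ A'.coalg).carrier →ₗ[k] R) : Prop where
  one_left : ∀ (X : CocommCoalgCat k) (g : X ⟶ A'.coalg), pull φ (lift 1 g) = 1
  mul_left : ∀ (X : CocommCoalgCat k) (f₁ f₂ : X ⟶ A.coalg) (g : X ⟶ A'.coalg),
    pull φ (lift (f₁ * f₂) g) = pull φ (lift f₁ g) * pull φ (lift f₂ g)
  mul_right : ∀ (X : CocommCoalgCat k) (f : X ⟶ A.coalg) (g₁ g₂ : X ⟶ A'.coalg),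
    pull φ (lift f (g₁ * g₂)) = pull φ (lift f g₁) * pull φ (lift f g₂)

namespace IsBilinearLinearMap

variable {R : Type u} [CommRing R] [Algebra k R]

theorem comp {R' : Type u} [CommRing R'] [Algebra k R'] (h : R →ₐ[k] R')
    {φ : (A.coalg ⊗ A'.coalg).carrier →ₗ[k] R} (hφ : IsBilinearLinearMap A A' φ) :
    IsBilinearLinearMap A A' (h.toLinearMap ∘ₗ φ) where
  one_left X g := by
    ext x
    exact (congrArg h (congrArg (fun f ↦ f.ofConv x) (hφ.one_left X g))).trans (h.commutes _)
  mul_left X f₁ f₂ g := by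
    ext x
    exact (congrArg h (congrArg (fun f ↦ f.ofConv x) (hφ.mul_left X f₁ f₂ g))).trans
      (algHom_pull_mul_pull h φ φ _ _ x)
  mul_right X f g₁ g₂ := by
    ext x
    exact (congrArg h (congrArg (fun f ↦ f.ofConv x) (hφ.mul_right X f g₁ g₂))).trans
      (algHom_pull_mul_pull h φ φ _ _ x)

/-- The sum of bilinear maps is bilinear. This uses that convolution is commutative, as `X` is
cocommutative and `R` is commutative. -/
theorem mul {φ ψ : WithConv ((A.coalg ⊗ A'.coalg).carrier →ₗ[k] R)}
    (hφ : IsBilinearLinearMap A A' φ.ofConv) (hψ : IsBilinearLinearMap A A' ψ.ofConv) :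
    IsBilinearLinearMap A A' (φ * ψ).ofConv where
  one_left X g := by rw [pull_mul, hφ.one_left, hψ.one_left, _root_.mul_one]
  mul_left X f₁ f₂ g := by
    simp only [pull_mul, hφ.mul_left, hψ.mul_left]
    exact mul_mul_mul_comm _ _ _ _
  mul_right X f g₁ g₂ := by
    simp only [pull_mul, hφ.mul_right, hψ.mul_right]
    exact mul_mul_mul_comm _ _ _ _

variable (A A' R) in
theorem one :
    IsBilinearLinearMap A A' (1 : WithConv ((A.coalg ⊗ A'.coalg).carrier →ₗ[k] R)).ofConv where
  one_left X g := pull_one _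
  mul_left X f₁ f₂ g := by rw [pull_one, pull_one, pull_one, _root_.mul_one]
  mul_right X f g₁ g₂ := by rw [pull_one, pull_one, pull_one, _root_.mul_one]

variable (A A') in
/-- Inversion in the first factor. -/
def invLeft : A.coalg ⊗ A'.coalg ⟶ A.coalg ⊗ A'.coalg := lift (fst A.coalg A'.coalg)⁻¹ (snd _ _)

theorem lift_comp_invLeft {X : CocommCoalgCat k} (f : X ⟶ A.coalg) (g : X ⟶ A'.coalg) :
    lift f g ≫ invLeft A A' = lift f⁻¹ g := by
  rw [invLeft, comp_lift, GrpObj.comp_inv, lift_fst, lift_snd]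

theorem comp_invLeft {φ : (A.coalg ⊗ A'.coalg).carrier →ₗ[k] R}
    (hφ : IsBilinearLinearMap A A' φ) :
    IsBilinearLinearMap A A' (φ ∘ₗ (invLeft A A').hom.toLinearMap) where
  one_left X g := by rw [← pull_comp, lift_comp_invLeft, inv_one, hφ.one_left]
  mul_left X f₁ f₂ g := by
    simp only [← pull_comp, lift_comp_invLeft]
    rw [mul_inv_rev, hφ.mul_left]
    exact mul_comm _ _
  mul_right X f g₁ g₂ := by simp only [← pull_comp, lift_comp_invLeft, hφ.mul_right]

/-- Precomposition with inversion in the first factor is inversion for convolution. -/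
theorem comp_invLeft_mul_self {φ : (A.coalg ⊗ A'.coalg).carrier →ₗ[k] R}
    (hφ : IsBilinearLinearMap A A' φ) :
    toConv (φ ∘ₗ (invLeft A A').hom.toLinearMap) * toConv φ = 1 := by
  have h := hφ.mul_left _ (fst A.coalg A'.coalg)⁻¹ (fst A.coalg A'.coalg) (snd A.coalg A'.coalg)
  rw [inv_mul_cancel, hφ.one_left, lift_fst_snd, pull_id] at h
  exact h.symm

end IsBilinearLinearMap

end Measuring

/-! ### The tensor product of abelian Hopf algebras -/

section HopfTensor

open MonoidalCategory CartesianMonoidalCategory MonObj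
open WithConv (toConv)
open scoped TensorProduct
open Algebra.TensorProduct (includeLeft includeRight)
open IsBilinearLinearMap

variable {k : Type u} [Field k] (A A' : AbHopf k)

/-- The elements of the symmetric algebra on `A ⊗ A'` that all bilinear linear maps annihilate. -/
def bilinearIdeal : Ideal (SymmetricAlgebra k (A.coalg ⊗ A'.coalg).carrier) where
  carrier := {x | ∀ (R : Type u) [CommRing R] [Algebra k R]
    (φ : (A.coalg ⊗ A'.coalg).carrier →ₗ[k] R), IsBilinearLinearMap A A' φ →
      SymmetricAlgebra.lift φ x = 0}
  add_mem' hx hy R _ _ φ hφ := by rw [map_add, hx R φ hφ, hy R φ hφ, add_zero]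
  zero_mem' R _ _ φ hφ := map_zero _
  smul_mem' c x hx R _ _ φ hφ := by rw [smul_eq_mul, map_mul, hx R φ hφ, mul_zero]

/-- The commutative algebra that classifies bilinear linear maps on `A ⊗ A'`. -/
def HopfTensor : Type u :=
  SymmetricAlgebra k (A.coalg ⊗ A'.coalg).carrier ⧸ bilinearIdeal A A'

namespace HopfTensor

instance : CommRing (HopfTensor A A') :=
  inferInstanceAs (CommRing (_ ⧸ bilinearIdeal A A'))

instance : Algebra k (HopfTensor A A') :=
  inferInstanceAs (Algebra k (_ ⧸ bilinearIdeal A A'))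

/-- The projection from the symmetric algebra. -/
def mk : SymmetricAlgebra k (A.coalg ⊗ A'.coalg).carrier →ₐ[k] HopfTensor A A' :=
  Ideal.Quotient.mkₐ k (bilinearIdeal A A')

/-- The universal bilinear linear map. -/
def univ : (A.coalg ⊗ A'.coalg).carrier →ₗ[k] HopfTensor A A' :=
  (mk A A').toLinearMap ∘ₗ SymmetricAlgebra.ι k _

variable {A A'}

/-- Equations in `HopfTensor A A'` can be checked under all bilinear linear maps. -/
theorem mk_eq_mk {x y : SymmetricAlgebra k (A.coalg ⊗ A'.coalg).carrier}
    (h : ∀ (R : Type u) [CommRing R] [Algebra k R] (φ : (A.coalg ⊗ A'.coalg).carrier →ₗ[k] R),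
      IsBilinearLinearMap A A' φ → SymmetricAlgebra.lift φ x = SymmetricAlgebra.lift φ y) :
    mk A A' x = mk A A' y :=
  Ideal.Quotient.eq.2 fun R _ _ φ hφ ↦ by rw [map_sub, h R φ hφ, sub_self]

theorem lift_comp_ι {R : Type u} [CommRing R] [Algebra k R]
    (φ : (A.coalg ⊗ A'.coalg).carrier →ₗ[k] R) :
    (SymmetricAlgebra.lift φ).toLinearMap ∘ₗ SymmetricAlgebra.ι k _ = φ := by
  ext x; simp

variable (A A') in
theorem isBilinearLinearMap_univ : IsBilinearLinearMap A A' (univ A A') where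
  one_left X g := by
    ext x
    refine Eq.trans (mk_eq_mk fun R _ _ φ hφ ↦ ?_) ((mk A A').commutes (Coalgebra.counit x))
    refine (LinearMap.congr_fun (lift_comp_ι φ) _).trans ?_
    exact (congrArg (fun f ↦ f.ofConv x) (hφ.one_left X g)).trans
      (AlgHom.commutes (SymmetricAlgebra.lift φ) _).symm
  mul_left X f₁ f₂ g := by
    ext x
    refine Eq.trans (mk_eq_mk fun R _ _ φ hφ ↦ ?_)
      (algHom_pull_mul_pull (mk A A') (SymmetricAlgebra.ι k _) (SymmetricAlgebra.ι k _) _ _ x)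
    refine (LinearMap.congr_fun (lift_comp_ι φ) _).trans ?_
    rw [algHom_pull_mul_pull, lift_comp_ι, ← hφ.mul_left]
    rfl
  mul_right X f g₁ g₂ := by
    ext x
    refine Eq.trans (mk_eq_mk fun R _ _ φ hφ ↦ ?_)
      (algHom_pull_mul_pull (mk A A') (SymmetricAlgebra.ι k _) (SymmetricAlgebra.ι k _) _ _ x)
    refine (LinearMap.congr_fun (lift_comp_ι φ) _).trans ?_
    rw [algHom_pull_mul_pull, lift_comp_ι, ← hφ.mul_right]
    rfl

/-- The algebra homomorphism given by a bilinear linear map. -/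
def desc {R : Type u} [CommRing R] [Algebra k R] {φ : (A.coalg ⊗ A'.coalg).carrier →ₗ[k] R}
    (hφ : IsBilinearLinearMap A A' φ) : HopfTensor A A' →ₐ[k] R :=
  Ideal.Quotient.liftₐ (bilinearIdeal A A') (SymmetricAlgebra.lift φ) fun _ hx ↦ hx R φ hφ

theorem desc_comp_univ {R : Type u} [CommRing R] [Algebra k R]
    {φ : (A.coalg ⊗ A'.coalg).carrier →ₗ[k] R} (hφ : IsBilinearLinearMap A A' φ) :
    (desc hφ).toLinearMap ∘ₗ univ A A' = φ :=
  lift_comp_ι φ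

theorem algHom_ext {R : Type u} [CommRing R] [Algebra k R] {f g : HopfTensor A A' →ₐ[k] R}
    (h : f.toLinearMap ∘ₗ univ A A' = g.toLinearMap ∘ₗ univ A A') : f = g :=
  Ideal.Quotient.algHom_ext k (SymmetricAlgebra.algHom_ext h)

variable (A A') in
/-- The comultiplication, by the convolution of the two maps to `T ⊗ T`. -/
def comul : HopfTensor A A' →ₐ[k] HopfTensor A A' ⊗[k] HopfTensor A A' :=
  desc (((isBilinearLinearMap_univ A A').comp includeLeft).mul
    (φ := toConv (_ ∘ₗ _)) (ψ := toConv (_ ∘ₗ _))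
    ((isBilinearLinearMap_univ A A').comp includeRight))

theorem comul_comp_univ : (comul A A').toLinearMap ∘ₗ univ A A' =
    TensorProduct.map (univ A A') (univ A A') ∘ₗ Coalgebra.comul := by
  refine (desc_comp_univ _).trans ?_
  have h : LinearMap.mul' k _ ∘ₗ TensorProduct.map
      (includeLeft.toLinearMap ∘ₗ univ A A') (includeRight.toLinearMap ∘ₗ univ A A') =
        TensorProduct.map (univ A A') (univ A A') :=
    TensorProduct.ext' fun x y ↦ by simp
  rw [← h]
  rfl

variable (A A') in
/-- The counit. -/
def counit : HopfTensor A A' →ₐ[k] k := desc (IsBilinearLinearMap.one A A' k)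

theorem counit_comp_univ : (counit A A').toLinearMap ∘ₗ univ A A' = Coalgebra.counit :=
  desc_comp_univ _

variable (A A') in
/-- The antipode, by inversion in the first factor. -/
def antipode : HopfTensor A A' →ₐ[k] HopfTensor A A' :=
  desc (isBilinearLinearMap_univ A A').comp_invLeft

instance : Bialgebra k (HopfTensor A A') :=
  .ofAlgHom (comul A A') (counit A A')
    (algHom_ext (LinearMap.ext fun x ↦ coassoc_of_comp_eq comul_comp_univ x))
    (algHom_ext (LinearMap.ext fun x ↦
      rTensor_counit_of_comp_eq comul_comp_univ counit_comp_univ x))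
    (algHom_ext (LinearMap.ext fun x ↦
      lTensor_counit_of_comp_eq comul_comp_univ counit_comp_univ x))

variable (A A') in
/-- The universal bilinear morphism. -/
def univHom : (A.coalg ⊗ A'.coalg).carrier →ₗc[k] HopfTensor A A' where
  toLinearMap := univ A A'
  counit_comp := counit_comp_univ
  map_comp_comul := comul_comp_univ.symm

instance : Coalgebra.IsCocomm k (HopfTensor A A') where
  comm_comp_comul := congrArg AlgHom.toLinearMap (algHom_ext (LinearMap.ext fun x ↦
    comm_of_comp_eq comul_comp_univ x) :
      (Algebra.TensorProduct.comm k (HopfTensor A A') (HopfTensor A A')).toAlgHom.comp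
        (comul A A') = comul A A')

/-- On generators, the convolution of algebra homomorphisms is that of bilinear linear maps. -/
theorem conv_comp_univ {R : Type u} [CommRing R] [Algebra k R] (f g : HopfTensor A A' →ₐ[k] R) :
    toConv ((f ⋇ g).toLinearMap ∘ₗ univ A A') =
      toConv (f.toLinearMap ∘ₗ univ A A') * toConv (g.toLinearMap ∘ₗ univ A A') :=
  congrArg toConv (LinearMap.convMul_comp_coalgHom_distrib (toConv f.toLinearMap)
    (toConv g.toLinearMap) (univHom A A'))

theorem antipode_conv_id : antipode A A' ⋇ AlgHom.id k _ = convUnit k _ (HopfTensor A A') := by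
  refine algHom_ext (WithConv.toConv_injective ((conv_comp_univ _ _).trans ?_))
  rw [antipode, desc_comp_univ]
  refine (isBilinearLinearMap_univ A A').comp_invLeft_mul_self.trans ?_
  rw [convUnit, AlgHom.comp_toLinearMap, LinearMap.comp_assoc]
  exact congrArg (fun f ↦ toConv ((Algebra.ofId k _).toLinearMap ∘ₗ f)) counit_comp_univ.symm

instance : HopfAlgebra k (HopfTensor A A') :=
  .ofAlgHom (antipode A A') ((conv_eq _ _).symm.trans antipode_conv_id)
    ((conv_eq _ _).symm.trans ((conv_comm _ _).trans antipode_conv_id))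

end HopfTensor

variable {A A'}

/-- For maps to a Hopf algebra the condition `one_left` is automatic, since `Hom(X, B)` is a
group. -/
theorem IsBilinear.isBilinearLinearMap {B : AbHopf k} {b : A.coalg ⊗ A'.coalg ⟶ B.coalg}
    (hb : IsBilinear (A := (AbHopf.toCommGrp k).obj A) (A' := (AbHopf.toCommGrp k).obj A')
      (B := (AbHopf.toCommGrp k).obj B) b) : IsBilinearLinearMap A A' b.hom.toLinearMap where
  one_left X g := by
    have h := hb.map_mul_left X 1 1 g
    rw [_root_.mul_one, left_eq_mul] at h
    exact (congrArg (fun f ↦ toConv f.hom.toLinearMap) h).trans toConv_one_hom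
  mul_left X f₁ f₂ g :=
    (congrArg (fun f ↦ toConv f.hom.toLinearMap) (hb.map_mul_left X f₁ f₂ g)).trans
      (toConv_mul_hom _ _)
  mul_right X f g₁ g₂ :=
    (congrArg (fun f ↦ toConv f.hom.toLinearMap) (hb.map_mul_right X f g₁ g₂)).trans
      (toConv_mul_hom _ _)

theorem IsBilinearLinearMap.isBilinear {B : AbHopf k} {b : A.coalg ⊗ A'.coalg ⟶ B.coalg}
    (hb : IsBilinearLinearMap A A' b.hom.toLinearMap) :
    IsBilinear (A := (AbHopf.toCommGrp k).obj A) (A' := (AbHopf.toCommGrp k).obj A')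
      (B := (AbHopf.toCommGrp k).obj B) b where
  map_mul_left X f₁ f₂ g := by
    have h : toConv (lift (f₁ * f₂) g ≫ b).hom.toLinearMap =
        toConv ((lift f₁ g ≫ b) * (lift f₂ g ≫ b)).hom.toLinearMap :=
      (hb.mul_left X f₁ f₂ g).trans (toConv_mul_hom (lift f₁ g ≫ b) (lift f₂ g ≫ b)).symm
    exact hom_ext_toConv h
  map_mul_right X f g₁ g₂ := by
    have h : toConv (lift f (g₁ * g₂) ≫ b).hom.toLinearMap =
        toConv ((lift f g₁ ≫ b) * (lift f g₂ ≫ b)).hom.toLinearMap :=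
      (hb.mul_right X f g₁ g₂).trans (toConv_mul_hom (lift f g₁ ≫ b) (lift f g₂ ≫ b)).symm
    exact hom_ext_toConv h

open HopfTensor in
/-- The homomorphism given by a bilinear morphism of coalgebras, as a homomorphism of
bialgebras. -/
def HopfTensor.descBialgHom {B : AbHopf k} {b : A.coalg ⊗ A'.coalg ⟶ B.coalg}
    (hb : IsBilinearLinearMap A A' b.hom.toLinearMap) : HopfTensor A A' →ₐc[k] B.obj :=
  .ofAlgHom (desc hb)
    (algHom_ext ((congrArg ((Coalgebra.counit (R := k) (A := B.obj)) ∘ₗ ·)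
      (desc_comp_univ hb)).trans (b.hom.counit_comp.trans counit_comp_univ.symm)))
    (algHom_ext (by
      have h₁ : (Algebra.TensorProduct.map (desc hb) (desc hb)).toLinearMap ∘ₗ
          (TensorProduct.map (univ A A') (univ A A') ∘ₗ Coalgebra.comul) =
            TensorProduct.map b.hom.toLinearMap b.hom.toLinearMap ∘ₗ Coalgebra.comul := by
        rw [← LinearMap.comp_assoc]
        refine congrArg (· ∘ₗ Coalgebra.comul) ?_
        refine (TensorProduct.map_comp _ _ _ _).symm.trans ?_
        exact congrArg₂ TensorProduct.map (desc_comp_univ hb) (desc_comp_univ hb)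
      refine (congrArg ((Algebra.TensorProduct.map (desc hb) (desc hb)).toLinearMap ∘ₗ ·)
        comul_comp_univ).trans (h₁.trans (b.hom.map_comp_comul.trans ?_))
      exact congrArg (Coalgebra.comul (R := k) (A := B.obj) ∘ₗ ·) (desc_comp_univ hb).symm))

open HopfTensor in
theorem hasTensorProducts_abHopf (k : Type u) [Field k] :
    HasTensorProducts (AbHopf.toCommGrp k) := fun A A' ↦ by
  let T : AbHopf k := ⟨CommHopfAlgCat.of k (HopfTensor A A'),
    inferInstanceAs (Coalgebra.IsCocomm k (HopfTensor A A'))⟩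
  let a : A.coalg ⊗ A'.coalg ⟶ T.coalg := ⟨univHom A A'⟩
  refine ⟨T, a, IsBilinearLinearMap.isBilinear (isBilinearLinearMap_univ A A'), fun B b hb ↦ ?_⟩
  refine ⟨ObjectProperty.homMk (CommHopfAlgCat.ofHom (descBialgHom hb.isBilinearLinearMap)),
    ?_, fun φ hφ ↦ ?_⟩
  · exact CocommCoalgCat.hom_ext (CoalgHom.coe_linearMap_injective
      (desc_comp_univ (R := B.obj) hb.isBilinearLinearMap))
  · refine ObjectProperty.hom_ext _ (CommHopfAlgCat.hom_ext ?_)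
    have h := algHom_ext (f := (φ.hom.hom : HopfTensor A A' →ₐ[k] B.obj))
      (g := desc hb.isBilinearLinearMap)
      ((congrArg (fun f ↦ f.hom.toLinearMap) hφ).trans
        (desc_comp_univ (R := B.obj) hb.isBilinearLinearMap).symm)
    ext x
    exact AlgHom.congr_fun h x

end HopfTensor

end AbTensor

end

/-- Tensor products exist in the category of abelian Hopf algebras over any field `k`, with respect
to bilinear morphisms of cocommutative coalgebras. If `k` is perfect, they also exist in the
category of abelian affine group schemes over `k`, with respect to bilinear morphisms of affine
schemes over `k`. -/
theorem mainTheorem1 (k : Type u) [Field k] :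
    AbTensor.HasTensorProducts (AbTensor.AbHopf.toCommGrp k) ∧
      (PerfectField k → AbTensor.HasTensorProducts (𝟭 (AbTensor.AbSch k))) := by
  exact ⟨AbTensor.hasTensorProducts_abHopf k, fun _ ↦ AbTensor.hasTensorProducts_abSch k⟩
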